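/- Let $A$ be an associative ring with unit and let $\xi$ be a ring automorphism of $A$. Let $A_\xi((z))$ be the twisted Novikov ring of formal Laurent series $\sum_{n} a_n z^n$ ($a_n\in A$, $n\in\mathbb Z$, $a_n=0$ for all sufficiently negative $n$), with multiplication determined by $az=z\,\xi(a)$ for $a\in A$; let $A_\xi[[z]]\subset A_\xi((z))$ be the subring of power series (only non-negative powers of $z$), and let $\epsilon:A_\xi[[z]]\to A$ be the augmentation $z\mapsto 0$. Every element of $1+A_\xi[[z]]z=\epsilon^{-1}(1)$ is a unit of $A_\xi[[z]]$, so this is a group under multiplication. Let $C$ be the subgroup of $1+A_\xi[[z]]z$ generated by the elements $$(1+ab)(1+ba)^{-1},\qquad a,b\in A_\xi[[z]],\quad \epsilon(ab)=\epsilon(ba)=0,$$ which is a normal subgroup. For a ring $R$ let $K_1(R)=\mathrm{GL}(R)^{\mathrm{ab}}$ be the abelianization of $\mathrm{GL}(R)=\varinjlim \mathrm{GL}_n(R)$, and let $$W_1(A,\xi)=\mathrm{Im}\bigl(1+A_\xi[[z]]z\to K_1(A_\xi((z)))\bigr),$$ where the map sends a unit $u$ to the class $[u]$ of the $1\times 1$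 matrix $(u)$. Corollary. The canonical map induces an isomorphism of groups $$\frac{1+A_\xi[[z]]z}{C}\;\xrightarrow{\ \cong\ }\;W_1(A,\xi),\qquad uC\mapsto [u].$$ -/

import Mathlib

/-! ### The twisted Novikov ring -/

/-- The (twisted) Novikov ring `A_ξ((z))`: formal Laurent series `∑ aₙ zⁿ`, `n ∈ ℤ`, with
coefficients in `A` written on the left and with only finitely many nonzero `aₙ` for `n < 0`.
Additively it is Mathlib's type of Laurent series; the multiplication, defined below, is
determined by `a z = z ξ(a)` for `a ∈ A`. -/
def NovikovRing {A : Type*} [Ring A] (_ξ : RingAut A) : Type _ := LaurentSeries A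

namespace NovikovRing

variable {A : Type*} [Ring A] {ξ : RingAut A}

instance : AddCommGroup (NovikovRing ξ) := inferInstanceAs (AddCommGroup (LaurentSeries A))

/-- The coefficient of `zⁿ`. -/
def coeff (f : NovikovRing ξ) (n : ℤ) : A := HahnSeries.coeff (Γ := ℤ) (R := A) f n

/-- The set of exponents with nonzero coefficient. -/
def support (f : NovikovRing ξ) : Set ℤ := HahnSeries.support (Γ := ℤ) (R := A) f

theorem isPWO_support (f : NovikovRing ξ) : f.support.IsPWO :=
  HahnSeries.isPWO_support (Γ := ℤ) (R := A) f

theorem mem_support (f : NovikovRing ξ) (n : ℤ) : n ∈ f.support ↔ f.coeff n ≠ 0 := Iff.rfl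

@[ext]
theorem ext {f g : NovikovRing ξ} (h : ∀ n, f.coeff n = g.coeff n) : f = g :=
  HahnSeries.ext (funext h)

@[simp] theorem coeff_zero (n : ℤ) : (0 : NovikovRing ξ).coeff n = 0 := rfl
@[simp] theorem coeff_add (f g : NovikovRing ξ) (n : ℤ) :
    (f + g).coeff n = f.coeff n + g.coeff n := rfl
@[simp] theorem coeff_neg (f : NovikovRing ξ) (n : ℤ) : (-f).coeff n = -f.coeff n := rfl

/-- The monomial `a zᵐ`. -/
noncomputable def monomial (m : ℤ) (a : A) : NovikovRing ξ :=
  (HahnSeries.single m a : LaurentSeries A)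

theorem coeff_monomial (m : ℤ) (a : A) (n : ℤ) :
    (monomial m a : NovikovRing ξ).coeff n = if n = m then a else 0 := by
  classical
  exact HahnSeries.coeff_single.trans (by simp)

noncomputable instance : One (NovikovRing ξ) := ⟨monomial 0 1⟩

theorem one_def : (1 : NovikovRing ξ) = monomial 0 1 := rfl

theorem coeff_one (n : ℤ) : (1 : NovikovRing ξ).coeff n = if n = 0 then 1 else 0 :=
  coeff_monomial 0 1 n

theorem support_bddBelow (f : NovikovRing ξ) : ∃ N : ℤ, ∀ n < N, f.coeff n = 0 := by
  by_cases hf : f.support.Nonempty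
  · refine ⟨f.isPWO_support.isWF.min hf, fun n hn => ?_⟩
    by_contra h
    exact f.isPWO_support.isWF.not_lt_min hf ((mem_support f n).2 h) hn
  · refine ⟨0, fun n _ => ?_⟩
    by_contra h
    exact hf ⟨n, (mem_support f n).2 h⟩

/-- The series with given coefficients, vanishing below some exponent. -/
noncomputable def mk (c : ℤ → A) (hc : ∃ N : ℤ, ∀ n < N, c n = 0) : NovikovRing ξ :=
  (HahnSeries.ofSuppBddBelow c (by
    obtain ⟨N, hN⟩ := hc
    exact ⟨N, fun n hn => not_lt.1 fun h => hn (hN n h)⟩) : LaurentSeries A)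

@[simp] theorem coeff_mk (c : ℤ → A) (hc : ∃ N : ℤ, ∀ n < N, c n = 0) (n : ℤ) :
    (mk c hc : NovikovRing ξ).coeff n = c n := rfl

/-- The `n`-th coefficient `∑_{i + j = n} aᵢ ξ⁻ⁱ(bⱼ)` of the product of `∑ aᵢ zⁱ` and
`∑ bⱼ zʲ`; only finitely many terms are nonzero. -/
noncomputable def mulCoeff (f g : NovikovRing ξ) (n : ℤ) : A :=
  ∑ᶠ i : ℤ, f.coeff i * (ξ ^ (-i)) (g.coeff (n - i))

theorem mulCoeff_eq_sum (f g : NovikovRing ξ) (n M N : ℤ) (hf : ∀ i < M, f.coeff i = 0)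
    (hg : ∀ i < N, g.coeff i = 0) :
    mulCoeff f g n = ∑ i ∈ Finset.Icc M (n - N), f.coeff i * (ξ ^ (-i)) (g.coeff (n - i)) := by
  refine finsum_eq_sum_of_support_subset _ fun i hi => ?_
  rw [Function.mem_support] at hi
  rw [Finset.coe_Icc, Set.mem_Icc]
  constructor
  · by_contra h
    exact hi (by rw [hf i (by lia), zero_mul])
  · by_contra h
    exact hi (by rw [hg (n - i) (by lia), map_zero, mul_zero])

noncomputable instance : Mul (NovikovRing ξ) where
  mul f g := mk (mulCoeff f g) (by
    obtain ⟨M, hM⟩ := f.support_bddBelow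
    obtain ⟨N, hN⟩ := g.support_bddBelow
    refine ⟨M + N, fun n hn => ?_⟩
    rw [mulCoeff_eq_sum f g n M N hM hN, Finset.Icc_eq_empty (by lia), Finset.sum_empty])

theorem coeff_mul (f g : NovikovRing ξ) (n : ℤ) :
    (f * g).coeff n = ∑ᶠ i : ℤ, f.coeff i * (ξ ^ (-i)) (g.coeff (n - i)) := rfl

theorem coeff_mul_eq_sum (f g : NovikovRing ξ) (n M N : ℤ) (hf : ∀ i < M, f.coeff i = 0)
    (hg : ∀ i < N, g.coeff i = 0) :
    (f * g).coeff n = ∑ i ∈ Finset.Icc M (n - N), f.coeff i * (ξ ^ (-i)) (g.coeff (n - i)) :=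
  mulCoeff_eq_sum f g n M N hf hg

theorem coeff_mul_eq_zero (f g : NovikovRing ξ) (n M N : ℤ) (hf : ∀ i < M, f.coeff i = 0)
    (hg : ∀ i < N, g.coeff i = 0) (hn : n < M + N) : (f * g).coeff n = 0 := by
  rw [coeff_mul_eq_sum f g n M N hf hg, Finset.Icc_eq_empty (by lia), Finset.sum_empty]

theorem coeff_monomial_mul (m : ℤ) (a : A) (g : NovikovRing ξ) (n : ℤ) :
    (monomial m a * g).coeff n = a * (ξ ^ (-m)) (g.coeff (n - m)) := by
  rw [coeff_mul, finsum_eq_single _ m]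
  · rw [coeff_monomial, if_pos rfl]
  · intro i hi
    rw [coeff_monomial, if_neg hi, zero_mul]

theorem coeff_mul_monomial (m : ℤ) (a : A) (f : NovikovRing ξ) (n : ℤ) :
    (f * monomial m a).coeff n = f.coeff (n - m) * (ξ ^ (-(n - m))) a := by
  rw [coeff_mul, finsum_eq_single _ (n - m)]
  · rw [coeff_monomial, if_pos (by lia)]
  · intro i hi
    rw [coeff_monomial, if_neg (by lia), map_zero, mul_zero]

protected theorem mul_assoc (f g h : NovikovRing ξ) : f * g * h = f * (g * h) := by
  obtain ⟨F, hF⟩ := f.support_bddBelow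
  obtain ⟨G, hG⟩ := g.support_bddBelow
  obtain ⟨H, hH⟩ := h.support_bddBelow
  ext n
  rw [coeff_mul_eq_sum (f * g) h n (F + G) H
      (fun i hi => coeff_mul_eq_zero f g i F G hF hG hi) hH,
    coeff_mul_eq_sum f (g * h) n F (G + H) hF
      (fun i hi => coeff_mul_eq_zero g h i G H hG hH hi)]
  simp only [coeff_mul_eq_sum f g _ F G hF hG, coeff_mul_eq_sum g h _ G H hG hH,
    Finset.sum_mul, map_sum, Finset.mul_sum, Finset.sum_sigma']
  refine Finset.sum_nbij' (fun p => ⟨p.2, p.1 - p.2⟩) (fun p => ⟨p.1 + p.2, p.1⟩) ?_ ?_ ?_ ?_ ?_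
  · rintro ⟨k, i⟩ hp
    simp only [Finset.mem_sigma, Finset.mem_Icc] at hp ⊢
    lia
  · rintro ⟨i, j⟩ hp
    simp only [Finset.mem_sigma, Finset.mem_Icc] at hp ⊢
    lia
  · rintro ⟨k, i⟩ _
    simp
  · rintro ⟨i, j⟩ _
    simp
  · rintro ⟨k, i⟩ _
    have e : ξ ^ (-k) = ξ ^ (-i) * ξ ^ (-(k - i)) := by rw [← zpow_add]; congr 1; ring
    simp only [map_mul, e, RingAut.mul_apply, mul_assoc]
    rw [show n - i - (k - i) = n - k by ring]

protected theorem mul_add (f g h : NovikovRing ξ) : f * (g + h) = f * g + f * h := by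
  obtain ⟨F, hF⟩ := f.support_bddBelow
  obtain ⟨G, hG⟩ := g.support_bddBelow
  obtain ⟨H, hH⟩ := h.support_bddBelow
  have hG' : ∀ i < min G H, g.coeff i = 0 := fun i hi => hG i (by lia)
  have hH' : ∀ i < min G H, h.coeff i = 0 := fun i hi => hH i (by lia)
  ext n
  rw [coeff_add, coeff_mul_eq_sum f _ n F (min G H) hF hG',
    coeff_mul_eq_sum f _ n F (min G H) hF hH',
    coeff_mul_eq_sum f _ n F (min G H) hF
      (fun i hi => by rw [coeff_add, hG' i hi, hH' i hi, add_zero]), ← Finset.sum_add_distrib]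
  exact Finset.sum_congr rfl fun i _ => by rw [coeff_add, map_add, mul_add]

protected theorem add_mul (f g h : NovikovRing ξ) : (f + g) * h = f * h + g * h := by
  obtain ⟨F, hF⟩ := f.support_bddBelow
  obtain ⟨G, hG⟩ := g.support_bddBelow
  obtain ⟨H, hH⟩ := h.support_bddBelow
  have hF' : ∀ i < min F G, f.coeff i = 0 := fun i hi => hF i (by lia)
  have hG' : ∀ i < min F G, g.coeff i = 0 := fun i hi => hG i (by lia)
  ext n
  rw [coeff_add, coeff_mul_eq_sum _ h n (min F G) H hF' hH,
    coeff_mul_eq_sum _ h n (min F G) H hG' hH,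
    coeff_mul_eq_sum _ h n (min F G) H
      (fun i hi => by rw [coeff_add, hF' i hi, hG' i hi, add_zero]) hH, ← Finset.sum_add_distrib]
  exact Finset.sum_congr rfl fun i _ => by rw [coeff_add, add_mul]

noncomputable instance : Ring (NovikovRing ξ) where
  __ := (inferInstance : AddCommGroup (NovikovRing ξ))
  mul_assoc := NovikovRing.mul_assoc
  one_mul f := by
    ext n
    rw [one_def, coeff_monomial_mul]
    simp
  mul_one f := by
    ext n
    rw [one_def, coeff_mul_monomial]
    simp
  left_distrib := NovikovRing.mul_add
  right_distrib := NovikovRing.add_mul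
  zero_mul f := by ext n; simp [coeff_mul]
  mul_zero f := by ext n; simp [coeff_mul]

/-- The commutation rule `a z = z ξ(a)`. -/
theorem monomial_zero_mul_z (a : A) :
    (monomial 0 a * monomial 1 1 : NovikovRing ξ) = monomial 1 1 * monomial 0 (ξ a) := by
  ext n
  rw [coeff_monomial_mul, coeff_monomial_mul, coeff_monomial, coeff_monomial]
  by_cases h : n = 1
  · subst h
    simp [← RingAut.mul_apply]
  · rw [if_neg (by lia), if_neg (by lia)]
    simp

end NovikovRing

/-! ### Twisted power series -/

/-- The twisted power series ring `A_ξ[[z]]`, as the subring of `A_ξ((z))` of all series without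
negative powers of `z`. -/
noncomputable def twistedPowerSeries {A : Type*} [Ring A] (ξ : RingAut A) :
    Subring (NovikovRing ξ) where
  carrier := {f | ∀ n < 0, f.coeff n = 0}
  mul_mem' {f g} hf hg n hn := NovikovRing.coeff_mul_eq_zero f g n 0 0 hf hg (by lia)
  one_mem' n hn := by rw [NovikovRing.coeff_one, if_neg (by lia)]
  add_mem' {f g} hf hg n hn := by rw [NovikovRing.coeff_add, hf n hn, hg n hn, add_zero]
  zero_mem' n _ := rfl
  neg_mem' {f} hf n hn := by rw [NovikovRing.coeff_neg, hf n hn, neg_zero]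

namespace twistedPowerSeries

open NovikovRing

variable {A : Type*} [Ring A] {ξ : RingAut A}

/-- The augmentation `ε : A_ξ[[z]] → A`, `z ↦ 0`. -/
noncomputable def augmentation (ξ : RingAut A) : twistedPowerSeries ξ →+* A where
  toFun f := (f : NovikovRing ξ).coeff 0
  map_one' := by rw [Subring.coe_one, coeff_one, if_pos rfl]
  map_mul' f g := by
    rw [Subring.coe_mul, coeff_mul_eq_sum _ _ 0 0 0 f.2 g.2, sub_zero, Finset.Icc_self,
      Finset.sum_singleton, neg_zero, zpow_zero, RingAut.one_apply, sub_zero]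
  map_zero' := rfl
  map_add' _ _ := rfl

theorem augmentation_apply (f : twistedPowerSeries ξ) :
    augmentation ξ f = (f : NovikovRing ξ).coeff 0 := rfl

/-- The indeterminate `z`. -/
noncomputable def z (ξ : RingAut A) : twistedPowerSeries ξ :=
  ⟨monomial 1 1, fun n hn => by rw [coeff_monomial, if_neg (by lia)]⟩

/-- `ε⁻¹(1) = 1 + A_ξ[[z]]z`. -/
theorem augmentation_eq_one_iff (u : twistedPowerSeries ξ) :
    augmentation ξ u = 1 ↔ ∃ f : twistedPowerSeries ξ, u = 1 + f * z ξ := by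
  constructor
  · intro hu
    rw [augmentation_apply] at hu
    refine ⟨⟨mk (fun n => if n < 0 then 0 else (u : NovikovRing ξ).coeff (n + 1))
      ⟨0, fun n hn => if_pos hn⟩, fun n hn => by rw [coeff_mk, if_pos hn]⟩, ?_⟩
    refine Subtype.ext (NovikovRing.ext fun n => ?_)
    rw [Subring.coe_add, Subring.coe_one, Subring.coe_mul, z, coeff_add, coeff_one, coeff_mul_monomial, coeff_mk, map_one, mul_one]
    rcases lt_trichotomy n 0 with h | h | h
    · rw [if_neg (by lia), if_pos (by lia), u.2 n h, add_zero]
    · subst h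
      simp [hu]
    · rw [if_neg (by lia), if_neg (by lia), zero_add, sub_add_cancel]
  · rintro ⟨f, rfl⟩
    have : augmentation ξ (z ξ) = 0 := by
      rw [augmentation_apply]
      exact (coeff_monomial 1 1 0).trans (if_neg (by lia))
    rw [map_add, map_mul, this, map_one, mul_zero, add_zero]

/-- The coefficients of a right inverse of a series `u` with constant coefficient `1`. -/
noncomputable def invCoeff (u : twistedPowerSeries ξ) (n : ℕ) : A :=
  if n = 0 then 1 else
    -∑ i : Fin n, (u : NovikovRing ξ).coeff ((i : ℤ) + 1) *
      (ξ ^ (-((i : ℤ) + 1))) (invCoeff u (n - 1 - i))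
  termination_by n
  decreasing_by lia

theorem exists_mul_eq_one (u : twistedPowerSeries ξ) (hu : augmentation ξ u = 1) :
    ∃ v : twistedPowerSeries ξ, augmentation ξ v = 1 ∧ u * v = 1 := by
  rw [augmentation_apply] at hu
  let v : twistedPowerSeries ξ :=
    ⟨mk (fun n => if n < 0 then 0 else invCoeff u n.toNat) ⟨0, fun n hn => if_pos hn⟩,
      fun n hn => by rw [coeff_mk, if_pos hn]⟩
  have hv : ∀ m : ℕ, (v : NovikovRing ξ).coeff m = invCoeff u m := fun m => by
    simp only [v]
    rw [coeff_mk, if_neg (by lia), Int.toNat_natCast]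
  have hv0 : (v : NovikovRing ξ).coeff 0 = 1 := by
    have := hv 0
    rw [invCoeff, if_pos rfl] at this
    exact this
  refine ⟨v, hv0, Subtype.ext (NovikovRing.ext fun n => ?_)⟩
  rw [Subring.coe_mul, Subring.coe_one, coeff_one]
  rcases lt_trichotomy n 0 with h | h | h
  · rw [if_neg (by lia), coeff_mul_eq_zero _ _ n 0 0 u.2 v.2 (by lia)]
  · subst h
    rw [if_pos rfl, ← Subring.coe_mul, ← augmentation_apply, map_mul, augmentation_apply,
      augmentation_apply, hu, hv0, mul_one]
  · obtain ⟨k, rfl⟩ : ∃ k : ℕ, n = ((k + 1 : ℕ) : ℤ) := ⟨(n - 1).toNat, by lia⟩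
    rw [if_neg (by lia), coeff_mul_eq_sum _ _ _ 0 0 u.2 v.2, sub_zero]
    have hsum : ∀ F : ℤ → A, ∑ i ∈ Finset.Icc (0 : ℤ) ((k + 1 : ℕ) : ℤ), F i =
        F 0 + ∑ i : Fin (k + 1), F ((i : ℤ) + 1) := by
      intro F
      have h1 : ∑ i ∈ Finset.range (k + 2), F (i : ℤ) =
          ∑ i ∈ Finset.Icc (0 : ℤ) ((k + 1 : ℕ) : ℤ), F i := by
        refine Finset.sum_nbij' (fun i : ℕ => (i : ℤ)) (fun i : ℤ => i.toNat) ?_ ?_ ?_ ?_ ?_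
        · intro i hi
          simp only [Finset.mem_range, Finset.mem_Icc] at hi ⊢
          lia
        · intro i hi
          simp only [Finset.mem_range, Finset.mem_Icc] at hi ⊢
          lia
        · intro i _
          simp
        · intro i hi
          simp only [Finset.mem_Icc] at hi
          lia
        · intro i _
          rfl
      rw [← h1, Finset.sum_range_succ', Finset.sum_range, add_comm]
      simp
    rw [hsum, sub_zero, hv, invCoeff, if_neg (by lia), hu, neg_zero, zpow_zero, one_mul,
      RingAut.one_apply, neg_add_eq_zero]
    refine Finset.sum_congr rfl fun i _ => ?_
    have hi := i.2
    rw [show ((k + 1 : ℕ) : ℤ) - ((i : ℤ) + 1) = ((k + 1 - 1 - i : ℕ) : ℤ) by lia, hv]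

/-- Every series with constant coefficient `1` is invertible. -/
theorem isUnit_of_augmentation_eq_one (u : twistedPowerSeries ξ) (hu : augmentation ξ u = 1) :
    IsUnit u := by
  obtain ⟨v, hv, huv⟩ := exists_mul_eq_one u hu
  obtain ⟨w, _, hvw⟩ := exists_mul_eq_one v hv
  have : w = u := by
    calc w = u * v * w := by rw [huv, one_mul]
      _ = u := by rw [mul_assoc, hvw, mul_one]
  exact ⟨⟨u, v, huv, this ▸ hvw⟩, rfl⟩

/-- The multiplicative group `1 + A_ξ[[z]]z`, as a subgroup of the units of `A_ξ[[z]]`: the units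
`u` with `ε(u) = 1`. By `isUnit_of_augmentation_eq_one` and `augmentation_eq_one_iff` its
elements are exactly the series `1 + f z`. -/
noncomputable def oneAddIdeal (ξ : RingAut A) : Subgroup (twistedPowerSeries ξ)ˣ :=
  (Units.map (augmentation ξ : twistedPowerSeries ξ →* A)).ker

theorem mem_oneAddIdeal (u : (twistedPowerSeries ξ)ˣ) :
    u ∈ oneAddIdeal ξ ↔ augmentation ξ (u : twistedPowerSeries ξ) = 1 := by
  rw [oneAddIdeal, MonoidHom.mem_ker, Units.ext_iff]
  rfl

/-- The generators of `C`: all `(1 + ab)(1 + ba)⁻¹` with `a, b ∈ A_ξ[[z]]` such that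
`ε(ab) = ε(ba) = 0`. -/
def commGenerators (ξ : RingAut A) : Set (oneAddIdeal ξ) :=
  {g | ∃ (a b : twistedPowerSeries ξ) (u v : oneAddIdeal ξ),
    augmentation ξ (a * b) = 0 ∧ augmentation ξ (b * a) = 0 ∧
    ((u : (twistedPowerSeries ξ)ˣ) : twistedPowerSeries ξ) = 1 + a * b ∧
    ((v : (twistedPowerSeries ξ)ˣ) : twistedPowerSeries ξ) = 1 + b * a ∧
    g = u * v⁻¹}

/-- The subgroup `C` of `1 + A_ξ[[z]]z`. -/
noncomputable def commSubgroup (ξ : RingAut A) : Subgroup (oneAddIdeal ξ) :=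
  Subgroup.closure (commGenerators ξ)

instance (ξ : RingAut A) : (commSubgroup ξ).Normal := by
  have key : ∀ (g x : oneAddIdeal ξ), x ∈ commGenerators ξ → g * x * g⁻¹ ∈ commGenerators ξ := by
    rintro g x ⟨a, b, u, v, hab, hba, hu, hv, rfl⟩
    let p : twistedPowerSeries ξ := ((g : (twistedPowerSeries ξ)ˣ) : twistedPowerSeries ξ)
    let q : twistedPowerSeries ξ := ((g⁻¹ : (twistedPowerSeries ξ)ˣ) : twistedPowerSeries ξ)
    have hpq : p * q = 1 := Units.mul_inv _
    have hqp : q * p = 1 := Units.inv_mul _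
    have h1 : ∀ c d : twistedPowerSeries ξ, (p * c * q) * (p * d * q) = p * (c * d) * q := by
      intro c d
      calc (p * c * q) * (p * d * q) = p * c * (q * p) * d * q := by simp only [mul_assoc]
        _ = _ := by rw [hqp, mul_one]; simp only [mul_assoc]
    have h2 : ∀ c : twistedPowerSeries ξ, p * (1 + c) * q = 1 + p * c * q := by
      intro c
      rw [mul_add, mul_one, add_mul, hpq]
    refine ⟨p * a * q, p * b * q, g * u * g⁻¹, g * v * g⁻¹, ?_, ?_, ?_, ?_, by group⟩
    · rw [h1, map_mul, map_mul, hab, mul_zero, zero_mul]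
    · rw [h1, map_mul, map_mul, hba, mul_zero, zero_mul]
    · rw [h1, ← h2, ← hu]
      rfl
    · rw [h1, ← h2, ← hv]
      rfl
  refine ⟨fun x hx g => ?_⟩
  have := Subgroup.mem_map_of_mem (MulAut.conj g).toMonoidHom hx
  rw [commSubgroup, MonoidHom.map_closure] at this
  refine Subgroup.closure_mono ?_ this
  rintro _ ⟨y, hy, rfl⟩
  exact key g y hy

end twistedPowerSeries

/-! ### The Whitehead group `K₁` -/

namespace StableGL

variable (R : Type*) [Ring R]

/-- The matrix `M ⊕ 1` of size `m ≥ n`, for `M` of size `n`. -/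
def blockMatrix {R : Type*} [Ring R] {n m : ℕ} (M : Matrix (Fin n) (Fin n) R) :
    Matrix (Fin m) (Fin m) R :=
  Matrix.of fun i j =>
    if h : (i : ℕ) < n ∧ (j : ℕ) < n then M ⟨i, h.1⟩ ⟨j, h.2⟩ else if i = j then 1 else 0

/-- The inclusion of matrices `M ↦ M ⊕ 1` for `n ≤ m`. -/
def matrixStab {n m : ℕ} (h : n ≤ m) :
    Matrix (Fin n) (Fin n) R →* Matrix (Fin m) (Fin m) R where
  toFun := blockMatrix
  map_one' := by
    ext i j
    simp only [blockMatrix, Matrix.of_apply, Matrix.one_apply, Fin.ext_iff]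
    split_ifs <;> rfl
  map_mul' M N := by
    obtain ⟨k, rfl⟩ := Nat.exists_eq_add_of_le h
    ext i j
    simp only [blockMatrix, Matrix.mul_apply, Matrix.of_apply, Fin.sum_univ_add]
    have h1 : ∀ (x : Fin n) (y : Fin k), ¬ n + (y : ℕ) = x := fun x y => by have := x.2; lia
    have h2 : ∀ (x : Fin n) (y : Fin k), ¬ (x : ℕ) = n + y := fun x y => by have := x.2; lia
    induction i using Fin.addCases <;> induction j using Fin.addCases <;>
      (simp [Fin.ext_iff, h1, h2]; try simp [Fin.val_inj])

/-- The stabilisation map `GLₙ(R) → GLₘ(R)`, `α ↦ α ⊕ 1`, for `n ≤ m`. -/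
def stab (n m : ℕ) (h : n ≤ m) : GL (Fin n) R →* GL (Fin m) R := Units.map (matrixStab R h)

instance : DirectedSystem (fun n : ℕ => GL (Fin n) R) (fun n m h => stab R n m h) where
  map_self n α := by
    refine Units.ext (Matrix.ext fun i j => ?_)
    simp [stab, matrixStab, blockMatrix]
  map_map n m k hnm hmk α := by
    refine Units.ext (Matrix.ext fun i j => ?_)
    simp only [stab, matrixStab, blockMatrix, Units.coe_map, MonoidHom.coe_mk, OneHom.coe_mk,
      Matrix.of_apply, Fin.ext_iff]
    split_ifs <;> first | rfl | lia

end StableGL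

/-- `GL(R)`, the direct limit of the groups `GLₙ(R)` along the inclusions `α ↦ α ⊕ 1`. -/
abbrev StableGL (R : Type*) [Ring R] : Type _ :=
  DirectLimit (fun n : ℕ => GL (Fin n) R) (StableGL.stab R)

/-- `K₁(R) = GL(R)^ab`. -/
abbrev K1 (R : Type*) [Ring R] : Type _ := Abelianization (StableGL R)

/-- The class in `GL(R)` of an invertible matrix. -/
noncomputable def StableGL.of (R : Type*) [Ring R] (n : ℕ) : GL (Fin n) R →* StableGL R where
  toFun α := ⟦⟨n, α⟩⟧
  map_one' := (DirectLimit.one_def n).symm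
  map_mul' α β := (DirectLimit.mul_def (f := StableGL.stab R) n α β).symm

/-- The canonical map `Rˣ → K₁(R)`, sending a unit to the class of the `1 × 1` matrix with that
entry. -/
noncomputable def K1.ofUnit (R : Type*) [Ring R] : Rˣ →* K1 R :=
  (Abelianization.of.comp (StableGL.of R 1)).comp
    (Units.map (Matrix.scalar (Fin 1) : R →+* Matrix (Fin 1) (Fin 1) R).toMonoidHom)

/-! ### The group `W₁(A, ξ)` -/

open twistedPowerSeries in
/-- The canonical map `1 + A_ξ[[z]]z → K₁(A_ξ((z)))`. -/
noncomputable def oneAddIdealToK1 {A : Type*} [Ring A] (ξ : RingAut A) :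
    oneAddIdeal ξ →* K1 (NovikovRing ξ) :=
  ((K1.ofUnit (NovikovRing ξ)).comp
    (Units.map ((twistedPowerSeries ξ).subtype : twistedPowerSeries ξ →* NovikovRing ξ))).comp
    (oneAddIdeal ξ).subtype

/-- `W₁(A, ξ)`, the image of `1 + A_ξ[[z]]z` in `K₁(A_ξ((z)))`. -/
noncomputable def W1 {A : Type*} [Ring A] (ξ : RingAut A) : Subgroup (K1 (NovikovRing ξ)) :=
  (oneAddIdealToK1 ξ).range

/-! Write `R = A_ξ[[z]]` and `V = (1 + Rz)/C`. That `C` dies in `K₁` is classical: `(1 + ab) ⊕ 1`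
and `1 ⊕ (1 + ba)` differ by elementary matrices (`K1.ofUnit_comm`). The content is the converse:
`[u] = 1` in `K₁(A_ξ((z)))` forces `u ∈ C`.

The group `V` is abelian, and the class map `d` satisfies `d (1 + ab) = d (1 + ba)`. Such a `d`
extends to a determinant: on matrices congruent to `1` modulo `z` as a product over Schur
complements (`idxDet_mul`, `idxDet_comm`), then on all of `GLₙ(R)` by splitting off the constant
part (`extDet_mul`, `extDet_comm`). This settles `K₁(R)`, but `z` still has to be inverted.

For that, a Novikov series `f` is replaced by its Toeplitz operator `T(f)` on `⨁_{j ≥ 0} A`, with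
entries `ξ⁻ⁱ(f_{j-i})`. `T` is multiplicative up to operators with finitely many nonzero rows, and
`T(f)` commutes with `σ z`, `σ` the shift, up to the first row. If an invertible operator `U` lifts
an invertible matrix `x`, the group commutator of `U` with `1 - σ z` is therefore `1` plus finitely
many rows, and a finite corner of it has a determinant in `V`: the torsion of `U`. It is
multiplicative (`torsion_mul`), and trivial on `1 +` finitely many rows
(`torsion_eq_one_of_finRows`) and on block unipotent operators (`torsion_eq_one_of_nilpotent`).

An invertible `x` need not lift to an invertible operator (`z` over a field does not). But by
Whitehead's lemma `[x, y] ⊕ 1` is a product of block unipotents and integral rotations, so it lifts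
with trivial torsion. On the other hand, for `u ∈ 1 + Rz` the operator `T(u)` is invertible with
torsion `d(u⁻¹)` (`torsion_toeplitzUnit`), because `(1 - σ z)⁻¹ e₀ = ∑ eₙ zⁿ` is an eigenvector of
`T(u)` with eigenvalue `u`. Comparing the two gives `d(u⁻¹) = 1`, that is `u ∈ C`. -/

/-! ### A determinant for matrices congruent to the identity -/

/-- A map `d` on a ring `R` which restricts to a homomorphism into a commutative group on the
elements congruent to `1` modulo the kernel of `ε`, and which satisfies the relations
`d (1 + ab) = d (1 + ba)`. -/
structure IsLocalDet {R A V : Type*} [Ring R] [Ring A] [CommGroup V] (ε : R →+* A) (d : R → V) :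
    Prop where
  isUnit : ∀ u, ε u = 1 → IsUnit u
  mul : ∀ u v, ε u = 1 → ε v = 1 → d (u * v) = d u * d v
  comm : ∀ a b, ε b = 0 → d (1 + a * b) = d (1 + b * a)

/-- The index type with `n` elements, built by adjoining one element at a time. -/
def Idx : ℕ → Type
  | 0 => Empty
  | n + 1 => Idx n ⊕ Unit

namespace Idx

instance instFintype : (n : ℕ) → Fintype (Idx n)
  | 0 => inferInstanceAs (Fintype Empty)
  | n + 1 => by
    have := instFintype n
    exact inferInstanceAs (Fintype (Idx n ⊕ Unit))

instance instDecidableEq : (n : ℕ) → DecidableEq (Idx n)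
  | 0 => inferInstanceAs (DecidableEq Empty)
  | n + 1 => by
    have := instDecidableEq n
    exact inferInstanceAs (DecidableEq (Idx n ⊕ Unit))

instance : IsEmpty (Idx 0) := inferInstanceAs (IsEmpty Empty)

theorem card (n : ℕ) : Fintype.card (Idx n) = n := by
  induction n with
  | zero => rfl
  | succ n ih =>
    have : Fintype.card (Idx (n + 1)) = Fintype.card (Idx n ⊕ Unit) := rfl
    rw [this, Fintype.card_sum, ih]
    rfl

end Idx

open Matrix

namespace LocalDet

variable {R A V : Type*} [Ring R] [Ring A] [CommGroup V]

/-- Block LDU factorisation with pivot `X`. -/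
theorem isUnit_fromBlocks {α β : Type*} [Fintype α] [Fintype β] [DecidableEq α] [DecidableEq β]
    {X X' : Matrix α α R} {b : Matrix α β R} {c : Matrix β α R} {e : Matrix β β R}
    (h : X * X' = 1) (h' : X' * X = 1) (he : IsUnit (e - c * X' * b)) :
    IsUnit (fromBlocks X b c e) := by
  obtain ⟨S, hS⟩ := he
  have h1 : fromBlocks X b c e =
      fromBlocks 1 0 (c * X') 1 * fromBlocks X 0 0 (S : Matrix β β R) *
        fromBlocks 1 (X' * b) 0 1 := by
    rw [fromBlocks_multiply, fromBlocks_multiply, hS]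
    simp [Matrix.mul_assoc, h']
    simp [← Matrix.mul_assoc, h]
  rw [h1]
  refine IsUnit.mul (IsUnit.mul ?_ ?_) ?_
  · exact isUnit_iff_exists.2 ⟨fromBlocks 1 0 (-(c * X')) 1, by simp [fromBlocks_multiply],
      by simp [fromBlocks_multiply]⟩
  · exact isUnit_iff_exists.2 ⟨fromBlocks X' 0 0 ((S⁻¹ : (Matrix β β R)ˣ) : Matrix β β R),
      by simp [fromBlocks_multiply, h], by simp [fromBlocks_multiply, h']⟩
  · exact isUnit_iff_exists.2 ⟨fromBlocks 1 (-(X' * b)) 0 1, by simp [fromBlocks_multiply],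
      by simp [fromBlocks_multiply]⟩

theorem one_add_fromRows_mul_fromCols {α β γ : Type*} [Fintype γ] [DecidableEq α] [DecidableEq β]
    (c' : Matrix α γ R) (c₁ : Matrix β γ R) (b' : Matrix γ α R) (b₁ : Matrix γ β R) :
    1 + fromRows c' c₁ * fromCols b' b₁ =
      fromBlocks (1 + c' * b') (c' * b₁) (c₁ * b') (1 + c₁ * b₁) := by
  rw [← fromBlocks_one, fromRows_mul_fromCols, fromBlocks_add, zero_add, zero_add]

/-- `d` as a function of `1 × 1` matrices. -/
def unitDet (d : R → V) (e : Matrix Unit Unit R) : V := d (e () ())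

/-- The determinant of an iterated block matrix, as the product of the values of `d` at the
successive Schur complements. -/
noncomputable def idxDet (d : R → V) : (n : ℕ) → Matrix (Idx n) (Idx n) R → V
  | 0, _ => 1
  | n + 1, M =>
    have M' : Matrix (Idx n ⊕ Unit) (Idx n ⊕ Unit) R := M
    idxDet d n M'.toBlocks₁₁ *
      unitDet d (M'.toBlocks₂₂ - M'.toBlocks₂₁ * Ring.inverse M'.toBlocks₁₁ * M'.toBlocks₁₂)

/-- On units `Ring.inverse` agrees with any given inverse, so its default value on non-units never
enters the computations below. -/
theorem idxDet_fromBlocks (d : R → V) (n : ℕ) {X X' : Matrix (Idx n) (Idx n) R}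
    (h : X * X' = 1) (h' : X' * X = 1) (b : Matrix (Idx n) Unit R) (c : Matrix Unit (Idx n) R)
    (e : Matrix Unit Unit R) :
    idxDet d (n + 1) (fromBlocks X b c e) = idxDet d n X * unitDet d (e - c * X' * b) := by
  have : Ring.inverse X = X' := Ring.inverse_unit (⟨X, X', h, h'⟩ : (Matrix _ _ R)ˣ)
  rw [← this]
  rfl

variable {ε : R →+* A} {d : R → V}

theorem map_mul_eq_one {α : Type*} [Fintype α] [DecidableEq α] {M N : Matrix α α R}
    (hM : M.map ε = 1) (hN : N.map ε = 1) : (M * N).map ε = 1 := by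
  rw [Matrix.map_mul, hM, hN, one_mul]

theorem map_one_add_mul {α β : Type*} [Fintype β] [DecidableEq α] (a : Matrix α β R)
    {b : Matrix β α R} (hb : b.map ε = 0) : (1 + a * b).map ε = 1 := by
  rw [Matrix.map_add ε (map_add ε), Matrix.map_mul, hb, Matrix.mul_zero, add_zero,
    Matrix.map_one _ (map_zero ε) (map_one ε)]

theorem map_one_add_mul' {α β : Type*} [Fintype β] [DecidableEq α] {a : Matrix α β R}
    (b : Matrix β α R) (ha : a.map ε = 0) : (1 + a * b).map ε = 1 := by
  rw [Matrix.map_add ε (map_add ε), Matrix.map_mul, ha, Matrix.zero_mul, add_zero,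
    Matrix.map_one _ (map_zero ε) (map_one ε)]

theorem unitDet_mul (H : IsLocalDet ε d) {P Q : Matrix Unit Unit R} (hP : P.map ε = 1)
    (hQ : Q.map ε = 1) : unitDet d (P * Q) = unitDet d P * unitDet d Q := by
  have h1 : ε (P () ()) = 1 := congrFun (congrFun hP ()) ()
  have h2 : ε (Q () ()) = 1 := congrFun (congrFun hQ ()) ()
  simp only [unitDet, Matrix.mul_apply, Finset.univ_unique, Finset.sum_singleton]
  exact H.mul _ _ h1 h2

theorem unitDet_comm (H : IsLocalDet ε d) (P : Matrix Unit Unit R) {Q : Matrix Unit Unit R}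
    (hQ : Q.map ε = 0) : unitDet d (1 + P * Q) = unitDet d (1 + Q * P) := by
  have h2 : ε (Q () ()) = 0 := congrFun (congrFun hQ ()) ()
  simp only [unitDet, Matrix.add_apply, Matrix.mul_apply, Finset.univ_unique,
    Finset.sum_singleton, Matrix.one_apply_eq]
  exact H.comm _ _ h2

theorem unitDet_one (H : IsLocalDet ε d) : unitDet d 1 = 1 := by
  have h : (1 : Matrix Unit Unit R).map ε = 1 := Matrix.map_one _ (map_zero ε) (map_one ε)
  have := unitDet_mul H h h
  rwa [mul_one, left_eq_mul] at this

theorem isUnit_unit (H : IsLocalDet ε d) {P : Matrix Unit Unit R} (hP : P.map ε = 1) :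
    IsUnit P := by
  obtain ⟨u, hu⟩ := H.isUnit (P () ()) (congrFun (congrFun hP ()) ())
  refine ⟨⟨P, Matrix.of fun _ _ => ((u⁻¹ : Rˣ) : R), ?_, ?_⟩, rfl⟩ <;> ext ⟨⟩ ⟨⟩ <;>
    simp [Matrix.mul_apply, ← hu]

/-- The off-diagonal blocks vanish under `ε`, so the Schur complement is again congruent to `1` and
the induction goes through. -/
theorem isUnit_idx (H : IsLocalDet ε d) (n : ℕ) (M : Matrix (Idx n) (Idx n) R)
    (hM : M.map ε = 1) : IsUnit M := by
  induction n with
  | zero => exact ⟨1, Subsingleton.elim _ _⟩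
  | succ n ih =>
    obtain ⟨X, b, c, e, rfl⟩ : ∃ X b c e, M = (fromBlocks X b c e :
        Matrix (Idx n ⊕ Unit) (Idx n ⊕ Unit) R) :=
      ⟨_, _, _, _, (fromBlocks_toBlocks (l := Idx n) (m := Unit) (n := Idx n) (o := Unit) M).symm⟩
    have hM' : (fromBlocks X b c e).map ε = (fromBlocks 1 0 0 1 :
        Matrix (Idx n ⊕ Unit) (Idx n ⊕ Unit) A) := hM.trans fromBlocks_one.symm
    rw [fromBlocks_map, fromBlocks_inj] at hM'
    obtain ⟨hX, hb, hc, he⟩ := hM'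
    obtain ⟨⟨X, X', h, h'⟩, rfl⟩ := ih X hX
    refine isUnit_fromBlocks h h' (isUnit_unit H ?_)
    rw [Matrix.map_sub ε (map_sub ε), Matrix.map_mul, hb, he, Matrix.mul_zero, sub_zero]

theorem exists_inverse_idx (H : IsLocalDet ε d) {n : ℕ} {M : Matrix (Idx n) (Idx n) R}
    (hM : M.map ε = 1) : ∃ M', M * M' = 1 ∧ M' * M = 1 ∧ M'.map ε = 1 := by
  obtain ⟨⟨X, X', h, h'⟩, rfl⟩ := isUnit_idx H n M hM
  refine ⟨X', h, h', ?_⟩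
  have := congrArg (fun Y => Y.map ε) h
  simp only [Matrix.map_mul] at this
  rw [show X.map ε = 1 from hM, one_mul] at this
  rw [this, Matrix.map_one _ (map_zero ε) (map_one ε)]

/-- The rank-one case, on which multiplicativity and the general exchange rule both rest. The Schur
complement is `1 + c₁ w b₁` with `w = (1 + b' c')⁻¹`; exchanging `c₁ w` and `b₁` turns the product
with `1 + b' c'` into `1 + b' c' + b₁ c₁`. -/
theorem idxDet_one_add_col_mul (H : IsLocalDet ε d) (n : ℕ) (c : Matrix (Idx n) Unit R)
    (b : Matrix Unit (Idx n) R) (hb : b.map ε = 0) :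
    idxDet d n (1 + c * b) = unitDet d (1 + b * c) := by
  induction n with
  | zero =>
    rw [idxDet, show b * c = 0 by ext; simp [Matrix.mul_apply], add_zero, unitDet_one H]
  | succ n ih =>
    obtain ⟨c', c₁, rfl⟩ : ∃ (c' : Matrix (Idx n) Unit R) (c₁ : Matrix Unit Unit R),
        c = fromRows c' c₁ :=
      ⟨_, _, (fromRows_toRows (m₁ := Idx n) (m₂ := Unit) c).symm⟩
    obtain ⟨b', b₁, rfl⟩ : ∃ (b' : Matrix Unit (Idx n) R) (b₁ : Matrix Unit Unit R),
        b = fromCols b' b₁ :=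
      ⟨_, _, (fromCols_toCols (n₁ := Idx n) (n₂ := Unit) b).symm⟩
    have hb' : b'.map ε = 0 := by
      ext i j
      exact congrFun (congrFun hb i) (Sum.inl j)
    have hb₁ : b₁.map ε = 0 := by
      ext i j
      exact congrFun (congrFun hb i) (Sum.inr j)
    have e1 : (1 + fromRows c' c₁ * fromCols b' b₁ : Matrix (Idx (n + 1)) (Idx (n + 1)) R) =
        (fromBlocks (1 + c' * b') (c' * b₁) (c₁ * b') (1 + c₁ * b₁) :
          Matrix (Idx n ⊕ Unit) (Idx n ⊕ Unit) R) :=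
      one_add_fromRows_mul_fromCols _ _ _ _
    have e2 : (fromCols b' b₁ * fromRows c' c₁ : Matrix Unit Unit R) = b' * c' + b₁ * c₁ :=
      fromCols_mul_fromRows _ _ _ _
    obtain ⟨W, hW, hW', hWε⟩ := exists_inverse_idx H (map_one_add_mul c' hb')
    refine (congrArg _ e1).trans ?_
    refine Eq.trans ?_ (congrArg (fun x => unitDet d (1 + x)) e2.symm)
    rw [idxDet_fromBlocks d n hW hW', ih _ _ hb']
    set w := 1 - b' * W * c' with hw
    have hw1 : w * (1 + b' * c') = 1 := by
      have : b' * W * c' * (1 + b' * c') = b' * (W * (1 + c' * b')) * c' := by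
        simp only [Matrix.mul_add, Matrix.add_mul, Matrix.mul_assoc, Matrix.mul_one]
      rw [hw, sub_mul, one_mul, this, hW', Matrix.mul_one, add_sub_cancel_right]
    have e3 : 1 + c₁ * b₁ - c₁ * b' * W * (c' * b₁) = 1 + c₁ * w * b₁ := by
      rw [hw]
      simp only [Matrix.mul_sub, Matrix.sub_mul, Matrix.mul_assoc, Matrix.mul_one, add_sub_assoc]
    rw [e3, unitDet_comm H _ hb₁, mul_comm, ← unitDet_mul H (map_one_add_mul' _ hb₁)
      (map_one_add_mul' _ hb')]
    congr 1
    rw [← mul_assoc, add_mul, mul_assoc _ w, hw1, one_mul, mul_one, add_assoc]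

theorem exists_fromBlocks (n : ℕ) (M : Matrix (Idx (n + 1)) (Idx (n + 1)) R)
    (hM : M.map ε = 1) : ∃ X b c e, M = (fromBlocks X b c e :
        Matrix (Idx n ⊕ Unit) (Idx n ⊕ Unit) R) ∧ X.map ε = 1 ∧ b.map ε = 0 ∧ c.map ε = 0 ∧
        e.map ε = 1 := by
  obtain ⟨X, b, c, e, rfl⟩ : ∃ X b c e, M = (fromBlocks X b c e :
        Matrix (Idx n ⊕ Unit) (Idx n ⊕ Unit) R) :=
      ⟨_, _, _, _, (fromBlocks_toBlocks (l := Idx n) (m := Unit) (n := Idx n) (o := Unit) M).symm⟩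
  have hM' : (fromBlocks X b c e).map ε = (fromBlocks 1 0 0 1 :
      Matrix (Idx n ⊕ Unit) (Idx n ⊕ Unit) A) := hM.trans fromBlocks_one.symm
  rw [fromBlocks_map, fromBlocks_inj] at hM'
  exact ⟨X, b, c, e, rfl, hM'⟩

/-- With `p = X⁻¹ b` and `q = c₂ Y⁻¹`, the product has pivot `X (1 + p q) Y` and Schur complement `s
(1 + q p)⁻¹ t`, where `s` and `t` are the Schur complements of the factors. The two extra
contributions cancel by the rank-one formula. -/
theorem idxDet_mul (H : IsLocalDet ε d) (n : ℕ) (M N : Matrix (Idx n) (Idx n) R)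
    (hM : M.map ε = 1) (hN : N.map ε = 1) : idxDet d n (M * N) = idxDet d n M * idxDet d n N := by
  induction n with
  | zero => simp [idxDet]
  | succ n ih =>
    obtain ⟨X, b, c, e, rfl, hX, hb, hc, he⟩ := exists_fromBlocks n M hM
    obtain ⟨Y, b₂, c₂, e₂, rfl, hY, hb₂, hc₂, he₂⟩ := exists_fromBlocks n N hN
    obtain ⟨X', h, h', hX'⟩ := exists_inverse_idx H hX
    obtain ⟨Y', k, k', hY'⟩ := exists_inverse_idx H hY
    set p := X' * b with hp
    set q := c₂ * Y' with hq
    have hpε : p.map ε = 0 := by rw [hp, Matrix.map_mul, hb, Matrix.mul_zero]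
    have hqε : q.map ε = 0 := by rw [hq, Matrix.map_mul, hc₂, Matrix.zero_mul]
    have hXp : X * p = b := by rw [hp, ← Matrix.mul_assoc, h, Matrix.one_mul]
    have hqY : q * Y = c₂ := by rw [hq, Matrix.mul_assoc, k', Matrix.mul_one]
    have hcp : c * X' * b = c * p := Matrix.mul_assoc _ _ _
    have hs : (e - c * p).map ε = 1 := by
      rw [Matrix.map_sub ε (map_sub ε), Matrix.map_mul, hpε, he, Matrix.mul_zero, sub_zero]
    have ht : (e₂ - q * b₂).map ε = 1 := by
      rw [Matrix.map_sub ε (map_sub ε), Matrix.map_mul, hb₂, he₂, Matrix.mul_zero, sub_zero]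
    obtain ⟨Z', z, z', hZ'⟩ := exists_inverse_idx H (map_one_add_mul p hqε)
    have e1 : (fromBlocks X b c e : Matrix (Idx n ⊕ Unit) (Idx n ⊕ Unit) R) *
        fromBlocks Y b₂ c₂ e₂ =
        fromBlocks (X * (1 + p * q) * Y) (X * (1 + p * q) * b₂ + X * p * (e₂ - q * b₂))
          (c * (1 + p * q) * Y + (e - c * p) * q * Y)
          (c * (1 + p * q) * b₂ + c * p * (e₂ - q * b₂) + (e - c * p) * q * b₂
            + (e - c * p) * (e₂ - q * b₂)) := by
      rw [fromBlocks_multiply]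
      congr 1
      · simp only [Matrix.mul_add, Matrix.add_mul, Matrix.mul_one, Matrix.mul_assoc, hqY]
        rw [← Matrix.mul_assoc X p, hXp]
      · simp only [Matrix.mul_add, Matrix.mul_sub, Matrix.add_mul, Matrix.mul_one,
          Matrix.mul_assoc]
        rw [← Matrix.mul_assoc X p, ← Matrix.mul_assoc X p, hXp]
        abel
      · simp only [Matrix.mul_add, Matrix.sub_mul, Matrix.add_mul, Matrix.mul_one,
          Matrix.mul_assoc, hqY]
        abel
      · simp only [Matrix.mul_add, Matrix.sub_mul, Matrix.mul_sub, Matrix.add_mul,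
          Matrix.mul_one, Matrix.mul_assoc]
        abel
    refine (congrArg (idxDet d (n + 1)) e1).trans ?_
    have i1 : X * (1 + p * q) * Y * (Y' * Z' * X') = 1 := by
      calc _ = X * (1 + p * q) * (Y * Y') * Z' * X' := by simp only [mul_assoc]
        _ = X * ((1 + p * q) * Z') * X' := by rw [k, mul_one]; simp only [mul_assoc]
        _ = 1 := by rw [z, mul_one, h]
    have i2 : (Y' * Z' * X') * (X * (1 + p * q) * Y) = 1 := by
      calc _ = Y' * Z' * (X' * X) * (1 + p * q) * Y := by simp only [mul_assoc]
        _ = Y' * (Z' * (1 + p * q)) * Y := by rw [h', mul_one]; simp only [mul_assoc]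
        _ = 1 := by rw [z', mul_one, k']
    rw [idxDet_fromBlocks d n i1 i2, idxDet_fromBlocks d n h h', idxDet_fromBlocks d n k k',
      ih _ _ (map_mul_eq_one hX (map_one_add_mul p hqε)) hY, ih _ _ hX (map_one_add_mul p hqε),
      idxDet_one_add_col_mul H n p q hqε, hcp, ← hq]
    have e2 : c * (1 + p * q) * b₂ + c * p * (e₂ - q * b₂) + (e - c * p) * q * b₂
            + (e - c * p) * (e₂ - q * b₂) -
          (c * (1 + p * q) * Y + (e - c * p) * q * Y) * (Y' * Z' * X') *
            (X * (1 + p * q) * b₂ + X * p * (e₂ - q * b₂)) =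
        (e - c * p) * (1 - q * Z' * p) * (e₂ - q * b₂) := by
      generalize e - c * p = s
      generalize e₂ - q * b₂ = t
      have j1 : (c * (1 + p * q) * Y + s * q * Y) * (Y' * Z' * X') =
          (c + s * q * Z') * X' := by
        calc _ = (c * (1 + p * q) + s * q) * (Y * Y') * Z' * X' := by
              simp only [Matrix.add_mul, Matrix.mul_assoc]
          _ = (c * ((1 + p * q) * Z') + s * q * Z') * X' := by
              rw [k, Matrix.mul_one]; simp only [Matrix.add_mul, Matrix.mul_assoc]
          _ = _ := by rw [z, Matrix.mul_one]
      have j2 : (c + s * q * Z') * X' * (X * (1 + p * q) * b₂ + X * p * t) =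
          c * (1 + p * q) * b₂ + c * p * t + s * q * b₂ + s * q * Z' * p * t := by
        calc _ = (c + s * q * Z') * (X' * X) * ((1 + p * q) * b₂ + p * t) := by
              rw [Matrix.mul_assoc X, Matrix.mul_assoc X, ← Matrix.mul_add]
              simp only [Matrix.mul_assoc]
          _ = c * ((1 + p * q) * b₂ + p * t) +
              s * q * ((Z' * (1 + p * q)) * b₂ + Z' * p * t) := by
              rw [h', Matrix.mul_one]
              simp only [Matrix.mul_add, Matrix.add_mul, Matrix.mul_assoc]
              abel
          _ = _ := by
              rw [z', Matrix.one_mul]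
              simp only [Matrix.mul_add, Matrix.add_mul, Matrix.mul_assoc]
              abel
      rw [j1, j2]
      simp only [Matrix.mul_sub, Matrix.sub_mul, Matrix.mul_one, Matrix.mul_assoc]
      abel
    -- Since `Z' = (1 + p q)⁻¹`, the middle factor `1 - q Z' p` is the inverse of `1 + q p`.
    have hw1 : (1 + q * p) * (1 - q * Z' * p) = 1 := by
      have : (1 + q * p) * (q * Z' * p) = q * ((1 + p * q) * Z') * p := by
        simp only [Matrix.mul_add, Matrix.add_mul, Matrix.mul_assoc, Matrix.one_mul]
      rw [mul_sub, mul_one, this, z, Matrix.mul_one, add_sub_cancel_right]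
    have hw2 : (1 - q * Z' * p).map ε = 1 := by
      rw [Matrix.map_sub ε (map_sub ε), Matrix.map_mul, hpε, Matrix.mul_zero, sub_zero,
        Matrix.map_one _ (map_zero ε) (map_one ε)]
    have hw3 : unitDet d (1 + q * p) * unitDet d (1 - q * Z' * p) = 1 := by
      rw [← unitDet_mul H (map_one_add_mul' p hqε) hw2, hw1, unitDet_one H]
    rw [e2, unitDet_mul H (map_mul_eq_one hs hw2) ht, unitDet_mul H hs hw2]
    calc _ = idxDet d n X * unitDet d (e - c * p) * (idxDet d n Y * unitDet d (e₂ - q * b₂)) *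
          (unitDet d (1 + q * p) * unitDet d (1 - q * Z' * p)) := by
          simp only [mul_assoc, mul_left_comm, mul_comm]
      _ = _ := by rw [hw3, mul_one]

/-- Peeling the last column off `a` and the last row off `b` changes `1 + a' b'` by a rank-one
factor and `1 + b' a'` by one bordering row and column. Both changes contribute `d (1 + b₁ W a₁)`
with `W = (1 + a' b')⁻¹`. -/
theorem idxDet_comm (H : IsLocalDet ε d) (n m : ℕ) (a : Matrix (Idx n) (Idx m) R)
    (b : Matrix (Idx m) (Idx n) R) (hb : b.map ε = 0) :
    idxDet d n (1 + a * b) = idxDet d m (1 + b * a) := by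
  induction m with
  | zero =>
    rw [idxDet, show a * b = 0 by ext; simp [Matrix.mul_apply], add_zero]
    -- The value at the identity of size `n` is read off from the rank-one formula with zero
    -- factors.
    have h1 := idxDet_one_add_col_mul H n (0 : Matrix (Idx n) Unit R) 0 (by ext; simp)
    rwa [Matrix.zero_mul, Matrix.zero_mul, add_zero, add_zero, unitDet_one H] at h1
  | succ m ih =>
    obtain ⟨a', a₁, rfl⟩ : ∃ (a' : Matrix (Idx n) (Idx m) R) (a₁ : Matrix (Idx n) Unit R),
        a = fromCols a' a₁ :=
      ⟨_, _, (fromCols_toCols (n₁ := Idx m) (n₂ := Unit) a).symm⟩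
    obtain ⟨b', b₁, rfl⟩ : ∃ (b' : Matrix (Idx m) (Idx n) R) (b₁ : Matrix Unit (Idx n) R),
        b = fromRows b' b₁ :=
      ⟨_, _, (fromRows_toRows (m₁ := Idx m) (m₂ := Unit) b).symm⟩
    have hb' : b'.map ε = 0 := by
      ext i j
      exact congrFun (congrFun hb (Sum.inl i)) j
    have hb₁ : b₁.map ε = 0 := by
      ext i j
      exact congrFun (congrFun hb (Sum.inr i)) j
    have e1 : (1 + fromRows b' b₁ * fromCols a' a₁ : Matrix (Idx (m + 1)) (Idx (m + 1)) R) =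
        (fromBlocks (1 + b' * a') (b' * a₁) (b₁ * a') (1 + b₁ * a₁) :
          Matrix (Idx m ⊕ Unit) (Idx m ⊕ Unit) R) :=
      one_add_fromRows_mul_fromCols _ _ _ _
    have e2 : (fromCols a' a₁ * fromRows b' b₁ : Matrix (Idx n) (Idx n) R) = a' * b' + a₁ * b₁ :=
      fromCols_mul_fromRows _ _ _ _
    refine (congrArg (fun x => idxDet d n (1 + x)) e2).trans ?_
    refine Eq.trans ?_ (congrArg _ e1.symm)
    obtain ⟨W, hW, hW', hWε⟩ := exists_inverse_idx H (map_one_add_mul a' hb')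
    obtain ⟨U, hU, hU', hUε⟩ := exists_inverse_idx H (map_one_add_mul' a' hb')
    have e3 : 1 + (a' * b' + a₁ * b₁) = (1 + a' * b') * (1 + W * a₁ * b₁) := by
      rw [mul_add, mul_one, Matrix.mul_assoc, ← Matrix.mul_assoc _ W, hW, Matrix.one_mul,
        add_assoc]
    have e4 : 1 - a' * U * b' = W := by
      have : (1 - a' * U * b') * (1 + a' * b') = 1 := by
        have : a' * U * b' * (1 + a' * b') = a' * (U * (1 + b' * a')) * b' := by
          simp only [Matrix.mul_add, Matrix.add_mul, Matrix.mul_assoc, Matrix.mul_one]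
        rw [sub_mul, one_mul, this, hU', Matrix.mul_one, add_sub_cancel_right]
      exact left_inv_eq_right_inv this hW
    rw [idxDet_fromBlocks d m hU hU', e3, idxDet_mul H n _ _ (map_one_add_mul a' hb')
      (map_one_add_mul _ hb₁), ih _ _ hb', idxDet_one_add_col_mul H n _ _ hb₁, ← e4]
    congr 2
    simp only [Matrix.mul_sub, Matrix.sub_mul, Matrix.mul_assoc, Matrix.one_mul, add_sub_assoc]

end LocalDet

/-! ### Determinants over arbitrary finite index types and for general invertible matrices. -/

namespace LocalDet

variable {R A V : Type*} [Ring R] [Ring A] [CommGroup V]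

/-- An enumeration of a finite type by the type `Idx`. -/
noncomputable def idxEquiv (α : Type*) [Fintype α] : α ≃ Idx (Fintype.card α) :=
  Fintype.equivOfCardEq (Idx.card _).symm

/-- The determinant of a square matrix congruent to `1`, indexed by any finite type. -/
noncomputable def det (d : R → V) {α : Type*} [Fintype α] (M : Matrix α α R) : V :=
  idxDet d (Fintype.card α) (reindex (idxEquiv α) (idxEquiv α) M)

variable {ε : R →+* A} {d : R → V} {α β : Type*} [Fintype α] [DecidableEq α] [Fintype β]
  [DecidableEq β]

omit [Fintype α] [DecidableEq β] in
theorem submatrix_one_add_mul {α' β' : Type*} [Fintype β'] [DecidableEq α'] (e : α' ≃ α)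
    (f : β' ≃ β) (a : Matrix α β R) (b : Matrix β α R) :
    (1 + a * b).submatrix e e = 1 + a.submatrix e f * b.submatrix f e := by
  rw [submatrix_add, submatrix_mul_equiv]
  simp

theorem det_mul (H : IsLocalDet ε d) {M N : Matrix α α R} (hM : M.map ε = 1)
    (hN : N.map ε = 1) : det d (M * N) = det d M * det d N := by
  have h : ∀ M : Matrix α α R, M.map ε = 1 →
      (reindex (idxEquiv α) (idxEquiv α) M).map ε = 1 := by
    intro M hM
    rw [reindex_apply, ← submatrix_map, hM, submatrix_one_equiv]
  rw [det, det, det, ← idxDet_mul H _ _ _ (h M hM) (h N hN)]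
  simp only [reindex_apply, submatrix_mul_equiv]

/-- The two index types are enumerated independently, so this rule also stands in for any proof that
the chosen enumeration is irrelevant. -/
theorem det_comm (H : IsLocalDet ε d) (a : Matrix α β R) {b : Matrix β α R} (hb : b.map ε = 0) :
    det d (1 + a * b) = det d (1 + b * a) := by
  rw [det, det, reindex_apply, reindex_apply, submatrix_one_add_mul _ (idxEquiv β).symm,
    submatrix_one_add_mul _ (idxEquiv α).symm]
  refine idxDet_comm H _ _ _ _ ?_
  rw [← submatrix_map, hb]
  rfl

theorem det_one_add_col_mul (H : IsLocalDet ε d) (c : Matrix α Unit R) {b : Matrix Unit α R}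
    (hb : b.map ε = 0) : det d (1 + c * b) = unitDet d (1 + b * c) := by
  rw [det, reindex_apply, submatrix_one_add_mul _ (Equiv.refl Unit), idxDet_one_add_col_mul H]
  · rw [submatrix_mul_equiv]
    rfl
  · rw [← submatrix_map, hb]
    rfl

theorem det_one (H : IsLocalDet ε d) : det d (1 : Matrix α α R) = 1 := by
  have h : (1 : Matrix α α R).map ε = 1 := Matrix.map_one _ (map_zero ε) (map_one ε)
  have := det_mul H h h
  rwa [mul_one, left_eq_mul] at this

/-- The conjugating matrix need not be congruent to `1`: in the exchange only the factor `(M - 1)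
m'` has to vanish under `ε`. -/
theorem det_conj (H : IsLocalDet ε d) {M : Matrix α α R} (hM : M.map ε = 1)
    {m m' : Matrix α α R} (h : m * m' = 1) (h' : m' * m = 1) :
    det d (m * M * m') = det d M := by
  have e1 : m * M * m' = 1 + m * ((M - 1) * m') := by
    rw [sub_mul, mul_sub, one_mul, h, ← mul_assoc, add_sub_cancel]
  have e2 : M = 1 + (M - 1) * m' * m := by
    rw [mul_assoc, h', mul_one, add_sub_cancel]
  rw [e1, det_comm H, ← e2]
  rw [Matrix.map_mul, Matrix.map_sub ε (map_sub ε), hM,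
    Matrix.map_one _ (map_zero ε) (map_one ε), sub_self, Matrix.zero_mul]

variable (ε d) (s : A →+* R)

/-- The determinant extended to all invertible matrices, trivial on those with entries in the
image of the section `s`. -/
noncomputable def extDet (M : Matrix α α R) : V :=
  det d (M * (Ring.inverse (M.map ε)).map s)

variable {ε d s}

theorem extDet_eq {M : Matrix α α R} {μ : Matrix α α A} (h : M.map ε * μ = 1)
    (h' : μ * M.map ε = 1) : extDet ε d s M = det d (M * μ.map s) := by
  rw [extDet]
  congr 3
  exact Ring.inverse_unit (⟨M.map ε, μ, h, h'⟩ : (Matrix α α A)ˣ)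

theorem extDet_of_map_eq_one {M : Matrix α α R} (hM : M.map ε = 1) :
    extDet ε d s M = det d M := by
  rw [extDet_eq (μ := 1) (by rw [hM, one_mul]) (by rw [hM, one_mul]),
    Matrix.map_one _ (map_zero s) (map_one s), mul_one]

theorem extDet_one (H : IsLocalDet ε d) : extDet ε d s (1 : Matrix α α R) = 1 := by
  rw [extDet_of_map_eq_one (Matrix.map_one _ (map_zero ε) (map_one ε)), det_one H]

omit [Fintype α] [DecidableEq α] in
theorem map_map_section (hs : ∀ a, ε (s a) = a) {β : Type*} (μ : Matrix α β A) :
    (μ.map s).map ε = μ := by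
  ext i j
  exact hs _

theorem exists_map_inverse {M : Matrix α α R} (hM : IsUnit M) :
    ∃ μ : Matrix α α A, M.map ε * μ = 1 ∧ μ * M.map ε = 1 := by
  obtain ⟨⟨M, N, h, h'⟩, rfl⟩ := hM
  refine ⟨N.map ε, ?_, ?_⟩
  · rw [← Matrix.map_mul]
    change (M * N).map ε = 1
    rw [h, Matrix.map_one _ (map_zero ε) (map_one ε)]
  · rw [← Matrix.map_mul]
    change (N * M).map ε = 1
    rw [h', Matrix.map_one _ (map_zero ε) (map_one ε)]

/-- Normalising `M N` gives the normalised `M` times the conjugate of the normalised `N` by the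
constant part of `M`; conjugation invariance removes that twist. -/
theorem extDet_mul (H : IsLocalDet ε d) (hs : ∀ a, ε (s a) = a) {M N : Matrix α α R}
    (hM : IsUnit M) (hN : IsUnit N) :
    extDet ε d s (M * N) = extDet ε d s M * extDet ε d s N := by
  obtain ⟨μ, h, h'⟩ := exists_map_inverse (ε := ε) hM
  obtain ⟨ν, k, k'⟩ := exists_map_inverse (ε := ε) hN
  have e1 : (M * N).map ε * (ν * μ) = 1 := by
    rw [Matrix.map_mul, mul_assoc, ← mul_assoc _ ν, k, one_mul, h]
  have e2 : ν * μ * (M * N).map ε = 1 := by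
    rw [Matrix.map_mul, mul_assoc, ← mul_assoc μ, h', one_mul, k']
  have hm : μ.map s * (M.map ε).map s = 1 := by
    rw [← Matrix.map_mul, h', Matrix.map_one _ (map_zero s) (map_one s)]
  have hm' : (M.map ε).map s * μ.map s = 1 := by
    rw [← Matrix.map_mul, h, Matrix.map_one _ (map_zero s) (map_one s)]
  have a1 : (M * μ.map s).map ε = 1 := by rw [Matrix.map_mul, map_map_section hs, h]
  have a2 : (N * ν.map s).map ε = 1 := by rw [Matrix.map_mul, map_map_section hs, k]
  have a3 : ((M.map ε).map s * (N * ν.map s) * μ.map s).map ε = 1 := by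
    rw [Matrix.map_mul, Matrix.map_mul, a2, mul_one, map_map_section hs, map_map_section hs, h]
  rw [extDet_eq e1 e2, extDet_eq h h', extDet_eq k k', ← det_conj H a2 hm' hm,
    ← det_mul H a1 a3]
  congr 1
  rw [Matrix.map_mul]
  calc _ = M * (N * ν.map s) * μ.map s := by simp only [mul_assoc]
    _ = M * (μ.map s * (M.map ε).map s) * (N * ν.map s) * μ.map s := by rw [hm, mul_one]
    _ = _ := by simp only [mul_assoc]

omit [Fintype α] in
theorem map_one_ringHom {B B' : Type*} [Ring B] [Ring B'] (f : B →+* B') :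
    (1 : Matrix α α B).map f = 1 := Matrix.map_one _ (map_zero f) (map_one f)

/-- Dividing by the constant part leaves an off-diagonal block `a` that vanishes under `ε`. The
matrix is then `1 + (1; 0)(0, a)`, and the product of these factors in the opposite order is zero.
-/
theorem extDet_upper (H : IsLocalDet ε d) (hs : ∀ a, ε (s a) = a) (a : Matrix α β R) :
    extDet ε d s (fromBlocks 1 a 0 1) = 1 := by
  have key : ∀ a : Matrix α β R, a.map ε = 0 → det d (fromBlocks 1 a 0 1) = 1 := by
    intro a ha
    have e : fromBlocks (1 : Matrix α α R) a 0 (1 : Matrix β β R) =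
        1 + fromRows (1 : Matrix α α R) (0 : Matrix β α R) * fromCols 0 a := by
      rw [one_add_fromRows_mul_fromCols]
      simp
    rw [e, det_comm H, fromCols_mul_fromRows]
    · simp [det_one H]
    · ext i (j | j)
      · simp
      · exact congrFun (congrFun ha i) j
  rw [extDet_eq (μ := fromBlocks 1 (-a.map ε) 0 1)]
  · rw [fromBlocks_map, fromBlocks_multiply]
    simp only [map_one_ringHom, mul_one, Matrix.map_zero _ (map_zero s),
      Matrix.mul_zero, Matrix.zero_mul, Matrix.mul_one, Matrix.one_mul, add_zero, zero_add]
    apply key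
    ext i j
    simp [hs]
  · simp [fromBlocks_map, fromBlocks_multiply]
  · simp [fromBlocks_map, fromBlocks_multiply]

theorem extDet_lower (H : IsLocalDet ε d) (hs : ∀ a, ε (s a) = a) (c : Matrix β α R) :
    extDet ε d s (fromBlocks 1 0 c 1) = 1 := by
  have key : ∀ c : Matrix β α R, c.map ε = 0 → det d (fromBlocks 1 0 c 1) = 1 := by
    intro c hc
    have e : fromBlocks (1 : Matrix α α R) 0 c (1 : Matrix β β R) =
        1 + fromRows (0 : Matrix α β R) (1 : Matrix β β R) * fromCols c 0 := by
      rw [one_add_fromRows_mul_fromCols]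
      simp
    rw [e, det_comm H, fromCols_mul_fromRows]
    · simp [det_one H]
    · ext i (j | j)
      · exact congrFun (congrFun hc i) j
      · simp
  rw [extDet_eq (μ := fromBlocks 1 0 (-c.map ε) 1)]
  · rw [fromBlocks_map, fromBlocks_multiply]
    simp only [map_one_ringHom, mul_one, Matrix.map_zero _ (map_zero s),
      Matrix.mul_zero, Matrix.zero_mul, Matrix.mul_one, Matrix.one_mul, add_zero, zero_add]
    apply key
    ext i j
    simp [hs]
  · simp [fromBlocks_map, fromBlocks_multiply]
  · simp [fromBlocks_map, fromBlocks_multiply]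

/-- Stability under `⊕ 1`: exchange the factors in `M ⊕ 1 = 1 + (1; 0)(M - 1, 0)`, where `M` is the
normalised `X`. -/
theorem extDet_blockDiag_left (H : IsLocalDet ε d) {X : Matrix α α R}
    (hX : IsUnit X) (hs : ∀ a, ε (s a) = a) :
    extDet ε d s (fromBlocks X 0 0 (1 : Matrix β β R)) = extDet ε d s X := by
  obtain ⟨μ, h, h'⟩ := exists_map_inverse (ε := ε) hX
  rw [extDet_eq h h', extDet_eq (μ := fromBlocks μ 0 0 1)]
  · rw [fromBlocks_map, fromBlocks_multiply]
    simp only [map_one_ringHom, mul_one, Matrix.map_zero _ (map_zero s),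
      Matrix.mul_zero, Matrix.zero_mul, add_zero, zero_add]
    have hM : (X * μ.map s).map ε = 1 := by rw [Matrix.map_mul, map_map_section hs, h]
    generalize X * μ.map s = M at hM
    have e : fromBlocks M 0 0 (1 : Matrix β β R) =
        1 + fromRows (1 : Matrix α α R) (0 : Matrix β α R) * fromCols (M - 1) 0 := by
      rw [one_add_fromRows_mul_fromCols]
      simp
    rw [e, det_comm H, fromCols_mul_fromRows]
    · simp
    · ext i (j | j)
      · simpa [sub_eq_zero, Matrix.one_apply, apply_ite ε] using congrFun (congrFun hM i) j
      · simp
  · simp [fromBlocks_map, fromBlocks_multiply, h]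
  · simp [fromBlocks_map, fromBlocks_multiply, h']

theorem extDet_blockDiag_right (H : IsLocalDet ε d) {X : Matrix β β R}
    (hX : IsUnit X) (hs : ∀ a, ε (s a) = a) :
    extDet ε d s (fromBlocks (1 : Matrix α α R) 0 0 X) = extDet ε d s X := by
  obtain ⟨μ, h, h'⟩ := exists_map_inverse (ε := ε) hX
  rw [extDet_eq h h', extDet_eq (μ := fromBlocks 1 0 0 μ)]
  · rw [fromBlocks_map, fromBlocks_multiply]
    simp only [map_one_ringHom, mul_one, Matrix.map_zero _ (map_zero s),
      Matrix.mul_zero, Matrix.zero_mul, add_zero, zero_add]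
    have hM : (X * μ.map s).map ε = 1 := by rw [Matrix.map_mul, map_map_section hs, h]
    generalize X * μ.map s = M at hM
    have e : fromBlocks (1 : Matrix α α R) 0 0 M =
        1 + fromRows (0 : Matrix α β R) (1 : Matrix β β R) * fromCols 0 (M - 1) := by
      rw [one_add_fromRows_mul_fromCols]
      simp
    rw [e, det_comm H, fromCols_mul_fromRows]
    · simp
    · ext i (j | j)
      · simp
      · simpa [sub_eq_zero, Matrix.one_apply, apply_ite ε] using congrFun (congrFun hM i) j
  · simp [fromBlocks_map, fromBlocks_multiply, h]
  · simp [fromBlocks_map, fromBlocks_multiply, h']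

/-- In contrast with `det_comm`, neither factor has to vanish under `ε`. Both sides of the identity
`e` below equal the block matrix with rows `(1, -a)` and `(b, 1)`, and the triangular factors have
trivial determinant. -/
theorem extDet_comm (H : IsLocalDet ε d) (hs : ∀ a, ε (s a) = a) (a : Matrix α β R)
    (b : Matrix β α R) (h : IsUnit (1 + a * b)) (h' : IsUnit (1 + b * a)) :
    extDet ε d s (1 + a * b) = extDet ε d s (1 + b * a) := by
  have u1 : IsUnit (fromBlocks (1 + a * b) 0 0 (1 : Matrix β β R)) := by
    obtain ⟨⟨X, Y, k, k'⟩, hX⟩ := h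
    change X = _ at hX
    exact isUnit_iff_exists.2 ⟨fromBlocks Y 0 0 1, by simp [fromBlocks_multiply, ← hX, k],
      by simp [fromBlocks_multiply, ← hX, k']⟩
  have u2 : IsUnit (fromBlocks (1 : Matrix α α R) 0 0 (1 + b * a)) := by
    obtain ⟨⟨X, Y, k, k'⟩, hX⟩ := h'
    change X = _ at hX
    exact isUnit_iff_exists.2 ⟨fromBlocks 1 0 0 Y, by simp [fromBlocks_multiply, ← hX, k],
      by simp [fromBlocks_multiply, ← hX, k']⟩
  have u3 : IsUnit (fromBlocks (1 : Matrix α α R) (-a) 0 (1 : Matrix β β R)) :=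
    isUnit_iff_exists.2 ⟨fromBlocks 1 a 0 1, by simp [fromBlocks_multiply],
      by simp [fromBlocks_multiply]⟩
  have u4 : IsUnit (fromBlocks (1 : Matrix α α R) 0 b (1 : Matrix β β R)) :=
    isUnit_iff_exists.2 ⟨fromBlocks 1 0 (-b) 1, by simp [fromBlocks_multiply],
      by simp [fromBlocks_multiply]⟩
  have e : fromBlocks (1 : Matrix α α R) (-a) 0 (1 : Matrix β β R) *
      fromBlocks (1 + a * b) 0 0 1 * fromBlocks 1 0 b 1 =
      fromBlocks (1 : Matrix α α R) 0 b (1 : Matrix β β R) *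
        (fromBlocks 1 0 0 (1 + b * a) * fromBlocks 1 (-a) 0 1) := by
    simp [fromBlocks_multiply]
  have e' := congrArg (extDet ε d s) e
  rwa [extDet_mul H hs (u3.mul u1) u4, extDet_mul H hs u3 u1, extDet_mul H hs u4 (u2.mul u3),
    extDet_mul H hs u2 u3, extDet_upper H hs, extDet_lower H hs, extDet_blockDiag_left H h hs,
    extDet_blockDiag_right H h' hs, one_mul, mul_one, one_mul, mul_one] at e'

theorem extDet_one_add_single (H : IsLocalDet ε d) (i : α) {x : R} (hx : ε x = 0) :
    extDet ε d s (1 + Matrix.single i i x) = d (1 + x) := by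
  have e : Matrix.single i i x = Matrix.of (fun j (_ : Unit) => if j = i then (1 : R) else 0) *
      Matrix.of (fun (_ : Unit) j => if j = i then x else 0) := by
    ext j k
    simp only [Matrix.mul_apply, Matrix.single_apply, Matrix.of_apply, Finset.univ_unique,
      Finset.sum_singleton]
    grind
  have hb : (Matrix.of (fun (_ : Unit) j => if j = i then x else 0)).map ε = 0 := by
    ext _ j
    simp [apply_ite ε, hx]
  rw [e, extDet_of_map_eq_one (map_one_add_mul _ hb), det_one_add_col_mul H _ hb, unitDet]
  simp [Matrix.mul_apply]

end LocalDet

/-! ### Elements with finitely many nonzero rows -/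

section FinRows

variable {B : Type*} [Ring B]

/-- The elements `X` with `e m * X = X` for some `m`. -/
def FinRows (e : ℕ → B) (X : B) : Prop := ∃ m, e m * X = X

/-- The elements `X` such that each `X * e m` is fixed by some `e m'`. -/
def ColBdd (e : ℕ → B) (X : B) : Prop := ∀ m, ∃ m', e m' * (X * e m) = X * e m

variable {e : ℕ → B}

theorem fixed_mono (he : ∀ a b, a ≤ b → e b * e a = e a) {X : B} {a b : ℕ} (hab : a ≤ b)
    (h : e a * X = X) : e b * X = X := by
  rw [← h, ← mul_assoc, he a b hab]

theorem FinRows.zero : FinRows e (0 : B) := ⟨0, mul_zero _⟩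

theorem FinRows.mul_right {X : B} (h : FinRows e X) (Y : B) : FinRows e (X * Y) := by
  obtain ⟨m, hm⟩ := h
  exact ⟨m, by rw [← mul_assoc, hm]⟩

theorem FinRows.neg {X : B} (h : FinRows e X) : FinRows e (-X) := by
  obtain ⟨m, hm⟩ := h
  exact ⟨m, by rw [mul_neg, hm]⟩

theorem FinRows.add (he : ∀ a b, a ≤ b → e b * e a = e a) {X Y : B} (hX : FinRows e X)
    (hY : FinRows e Y) : FinRows e (X + Y) := by
  obtain ⟨m, hm⟩ := hX
  obtain ⟨n, hn⟩ := hY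
  exact ⟨max m n, by rw [mul_add, fixed_mono he (le_max_left m n) hm,
    fixed_mono he (le_max_right m n) hn]⟩

theorem FinRows.sub (he : ∀ a b, a ≤ b → e b * e a = e a) {X Y : B} (hX : FinRows e X)
    (hY : FinRows e Y) : FinRows e (X - Y) := by
  rw [sub_eq_add_neg]
  exact hX.add he hY.neg

/-- Elements with finitely many rows are stable under all right multiplications, but on the left
only under column-bounded ones. For power series this is a real restriction: the `n`-th coefficient
of `(1 - σ z)⁻¹` sends the first basis vector `e₀` to `eₙ`, so that inverse is not column bounded.
-/
theorem ColBdd.mul_finRows {X Y : B} (hX : ColBdd e X) (hY : FinRows e Y) :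
    FinRows e (X * Y) := by
  obtain ⟨m, hm⟩ := hY
  obtain ⟨m', hm'⟩ := hX m
  exact ⟨m', by rw [← hm, ← mul_assoc X, ← mul_assoc, hm']⟩

theorem ColBdd.sub (he : ∀ a b, a ≤ b → e b * e a = e a) {X Y : B} (hX : ColBdd e X)
    (hY : ColBdd e Y) : ColBdd e (X - Y) := by
  intro m
  rw [sub_mul]
  exact FinRows.sub he (hX m) (hY m)

theorem ColBdd.mul {X Y : B} (hX : ColBdd e X) (hY : ColBdd e Y) : ColBdd e (X * Y) := by
  intro m
  rw [mul_assoc]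
  exact hX.mul_finRows (hY m)

theorem ColBdd.one (he : ∀ a b, a ≤ b → e b * e a = e a) : ColBdd e (1 : B) := fun m =>
  ⟨m, by rw [one_mul, he m m le_rfl]⟩

end FinRows

/-! ### Column-finite matrices -/

/-- The ring of column-finite `ℕ × ℕ` matrices over `A`, as endomorphisms of the free right
module of countable rank. -/
def ColumnFinite (A : Type*) [Ring A] : Type _ := Module.End Aᵐᵒᵖ (ℕ →₀ A)

namespace ColumnFinite

open MulOpposite

variable {A : Type*} [Ring A]

noncomputable instance : Ring (ColumnFinite A) :=
  inferInstanceAs (Ring (Module.End Aᵐᵒᵖ (ℕ →₀ A)))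

/-- A column-finite matrix as an endomorphism. -/
def toEnd (X : ColumnFinite A) : Module.End Aᵐᵒᵖ (ℕ →₀ A) := X

theorem toEnd_mul_apply (X Y : ColumnFinite A) (v : ℕ →₀ A) :
    (X * Y).toEnd v = X.toEnd (Y.toEnd v) := rfl

/-- The `(i, j)` entry. -/
noncomputable def entry (i j : ℕ) : ColumnFinite A →+ A where
  toFun X := X.toEnd (Finsupp.single j 1) i
  map_zero' := rfl
  map_add' _ _ := rfl

theorem entry_apply (i j : ℕ) (X : ColumnFinite A) :
    entry i j X = X.toEnd (Finsupp.single j 1) i := rfl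

theorem apply_single (X : ColumnFinite A) (i j : ℕ) (a : A) :
    X.toEnd (Finsupp.single j a) i = entry i j X * a := by
  have : Finsupp.single j a = op a • Finsupp.single j (1 : A) := by
    rw [Finsupp.smul_single, op_smul_eq_mul, one_mul]
  rw [this, map_smul, Finsupp.smul_apply, op_smul_eq_mul, entry_apply]

theorem apply_eq_sum (X : ColumnFinite A) (v : ℕ →₀ A) (i m : ℕ) (hv : ∀ k, m ≤ k → v k = 0) :
    X.toEnd v i = ∑ k ∈ Finset.range m, entry i k X * v k := by
  have h : v = ∑ k ∈ Finset.range m, Finsupp.single k (v k) := by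
    ext j
    rw [Finsupp.finsetSum_apply]
    by_cases hj : j < m
    · rw [Finset.sum_eq_single_of_mem j (Finset.mem_range.2 hj)]
      · simp
      · intro k _ hk
        exact Finsupp.single_eq_of_ne hk.symm
    · rw [hv j (not_lt.1 hj), Finset.sum_eq_zero]
      intro k hk
      exact Finsupp.single_eq_of_ne (by have := Finset.mem_range.1 hk; lia)
  conv_lhs => rw [h]
  rw [map_sum, Finsupp.finsetSum_apply]
  exact Finset.sum_congr rfl fun k _ => apply_single X i k _

theorem exists_bound (X : ColumnFinite A) (j : ℕ) : ∃ m, ∀ k, m ≤ k → entry k j X = 0 := by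
  refine ⟨(X.toEnd (Finsupp.single j 1)).support.sup id + 1, fun k hk => ?_⟩
  by_contra h
  have := Finset.le_sup (f := id) (Finsupp.mem_support_iff.2 h)
  simp only [id] at this
  lia

theorem entry_mul (X Y : ColumnFinite A) (i j m : ℕ) (hY : ∀ k, m ≤ k → entry k j Y = 0) :
    entry i j (X * Y) = ∑ k ∈ Finset.range m, entry i k X * entry k j Y :=
  apply_eq_sum X _ i m hY

theorem ext_entry {X Y : ColumnFinite A} (h : ∀ i j, entry i j X = entry i j Y) : X = Y := by
  suffices X.toEnd = Y.toEnd from this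
  refine LinearMap.ext fun v => Finsupp.ext fun i => ?_
  have hv : ∀ k, v.support.sup id + 1 ≤ k → v k = 0 := by
    intro k hk
    by_contra h
    have := Finset.le_sup (f := id) (Finsupp.mem_support_iff.2 h)
    simp only [id] at this
    lia
  rw [apply_eq_sum X v i _ hv, apply_eq_sum Y v i _ hv]
  simp only [h]

/-- The column-finite matrix with given columns. -/
noncomputable def ofCols (c : ℕ → ℕ →₀ A) : ColumnFinite A :=
  Finsupp.lsum (M := A) (N := ℕ →₀ A) (R := Aᵐᵒᵖ) ℕ fun j =>
    { toFun := fun a => op a • c j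
      map_add' := fun a b => by rw [op_add, add_smul]
      map_smul' := fun b a => by
        rw [RingHom.id_apply, smul_smul]
        congr 1 }

theorem ofCols_single (c : ℕ → ℕ →₀ A) (j : ℕ) :
    (ofCols c).toEnd (Finsupp.single j 1) = c j := by
  refine (Finsupp.lsum_single _ _ _ _).trans ?_
  change op (1 : A) • c j = c j
  rw [op_one, one_smul]

theorem entry_ofCols (c : ℕ → ℕ →₀ A) (i j : ℕ) : entry i j (ofCols c) = c j i := by
  rw [entry_apply, ofCols_single]

theorem entry_one (i j : ℕ) : entry i j (1 : ColumnFinite A) = if i = j then 1 else 0 := by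
  change Finsupp.single j (1 : A) i = _
  rw [Finsupp.single_apply]
  simp only [eq_comm]

/-- The entrywise action of a ring homomorphism. -/
noncomputable def mapEntries (η : A →+* A) (X : ColumnFinite A) : ColumnFinite A :=
  ofCols fun j => (X.toEnd (Finsupp.single j 1)).mapRange η (map_zero η)

theorem entry_mapEntries (η : A →+* A) (X : ColumnFinite A) (i j : ℕ) :
    entry i j (mapEntries η X) = η (entry i j X) := by
  rw [mapEntries, entry_ofCols]
  rfl

theorem mapEntries_mul (η : A →+* A) (X Y : ColumnFinite A) :
    mapEntries η (X * Y) = mapEntries η X * mapEntries η Y := by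
  refine ext_entry fun i j => ?_
  obtain ⟨m, hm⟩ := exists_bound Y j
  rw [entry_mapEntries, entry_mul X Y i j m hm, entry_mul _ _ i j m
    (fun k hk => by rw [entry_mapEntries, hm k hk, map_zero]), map_sum]
  simp only [map_mul, entry_mapEntries]

/-- The entrywise action of the automorphisms of `A` on column-finite matrices. -/
noncomputable def mapAut : RingAut A →* RingAut (ColumnFinite A) where
  toFun η :=
    { toFun := mapEntries (η : A →+* A)
      invFun := mapEntries ((η⁻¹ : RingAut A) : A →+* A)
      left_inv := fun X => ext_entry fun i j => by
        rw [entry_mapEntries, entry_mapEntries]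
        exact RingEquiv.symm_apply_apply η _
      right_inv := fun X => ext_entry fun i j => by
        rw [entry_mapEntries, entry_mapEntries]
        exact RingEquiv.apply_symm_apply η _
      map_mul' := mapEntries_mul _
      map_add' := fun X Y => ext_entry fun i j => by
        simp only [map_add, entry_mapEntries] }
  map_one' := RingEquiv.ext fun X => ext_entry fun i j => entry_mapEntries _ X i j
  map_mul' η θ := RingEquiv.ext fun X => ext_entry fun i j => by
    change entry i j (mapEntries _ X) = entry i j (mapEntries _ (mapEntries _ X))
    simp only [entry_mapEntries]
    rfl

theorem entry_mapAut (η : RingAut A) (X : ColumnFinite A) (i j : ℕ) :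
    entry i j (mapAut η X) = η (entry i j X) :=
  entry_mapEntries _ X i j

theorem entry_mapAut_zpow (η : RingAut A) (n : ℤ) (X : ColumnFinite A) (i j : ℕ) :
    entry i j ((mapAut η ^ n) X) = (η ^ n) (entry i j X) := by
  rw [← map_zpow, entry_mapAut]

/-- The projection to the first `m` coordinates. -/
noncomputable def proj (m : ℕ) : ColumnFinite A :=
  ofCols fun j => if j < m then Finsupp.single j 1 else 0

theorem entry_proj_mul (m : ℕ) (X : ColumnFinite A) (i j : ℕ) :
    entry i j (proj m * X) = if i < m then entry i j X else 0 := by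
  have h : ∀ k, entry i k (proj m : ColumnFinite A) = if i = k ∧ i < m then 1 else 0 := by
    intro k
    rw [proj, entry_ofCols]
    split_ifs <;> simp [Finsupp.single_apply] <;> lia
  obtain ⟨n, hn⟩ := exists_bound X j
  rw [entry_mul _ _ i j (max n (i + 1)) fun k hk => hn k (by lia),
    Finset.sum_eq_single_of_mem i (Finset.mem_range.2 (by lia))]
  · rw [h]
    split_ifs <;> simp_all
  · intro k _ hk
    rw [h, if_neg (by lia), zero_mul]

theorem entry_mul_proj (m : ℕ) (X : ColumnFinite A) (i j : ℕ) :
    entry i j (X * proj m) = if j < m then entry i j X else 0 := by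
  rw [entry_apply, toEnd_mul_apply, proj, ofCols_single]
  split_ifs
  · rfl
  · simp

/-- The shift of the basis vectors. -/
noncomputable def shift : ColumnFinite A := ofCols fun j => Finsupp.single (j + 1) 1

theorem entry_mul_shift (X : ColumnFinite A) (i j : ℕ) :
    entry i j (X * shift) = entry i (j + 1) X := by
  rw [entry_apply, toEnd_mul_apply, shift, ofCols_single]
  rfl

theorem entry_shift_mul (X : ColumnFinite A) (i j : ℕ) :
    entry i j (shift * X) = if i = 0 then 0 else entry (i - 1) j X := by
  have h : ∀ k, entry i k (shift : ColumnFinite A) = if i = k + 1 then 1 else 0 := by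
    intro k
    rw [shift, entry_ofCols, Finsupp.single_apply]
    simp only [eq_comm]
  obtain ⟨n, hn⟩ := exists_bound X j
  rw [entry_mul _ _ i j (max n i) fun k hk => hn k (by lia)]
  simp only [h]
  split_ifs with hi
  · exact Finset.sum_eq_zero fun k _ => by rw [if_neg (by lia), zero_mul]
  · rw [Finset.sum_eq_single_of_mem (i - 1) (Finset.mem_range.2 (by lia))]
    · rw [if_pos (by lia), one_mul]
    · intro k _ hk
      rw [if_neg (by lia), zero_mul]

theorem proj_mul_proj (a b : ℕ) (h : a ≤ b) : proj b * proj a = (proj a : ColumnFinite A) := by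
  refine ext_entry fun i j => ?_
  rw [entry_proj_mul, ← mul_one (proj a), entry_proj_mul]
  split_ifs <;> first | rfl | lia

/-- The entries are `0` and `1`, so the twist fixes the projections and they commute with `z`. -/
theorem mapAut_proj (η : RingAut A) (m : ℕ) : mapAut η (proj m) = proj m := by
  refine ext_entry fun i j => ?_
  rw [entry_mapAut, ← mul_one (proj m), entry_proj_mul, entry_one]
  split_ifs <;> simp

theorem colBdd (X : ColumnFinite A) : ColBdd proj X := by
  intro m
  choose f hf using exists_bound X
  refine ⟨(Finset.range m).sup f, ext_entry fun i j => ?_⟩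
  rw [entry_proj_mul, entry_mul_proj]
  split_ifs with h1 h2
  · rfl
  · rfl
  · rename_i h2
    exact (hf j i (le_trans (Finset.le_sup (Finset.mem_range.2 h2)) (not_lt.1 h1))).symm
  · rfl

theorem finRows_iff (m : ℕ) (X : ColumnFinite A) :
    proj m * X = X ↔ ∀ i j, m ≤ i → entry i j X = 0 := by
  constructor
  · intro h i j hi
    rw [← h, entry_proj_mul, if_neg (not_lt.2 hi)]
  · intro h
    refine ext_entry fun i j => ?_
    rw [entry_proj_mul]
    split_ifs with hi
    · rfl
    · rw [h i j (not_lt.1 hi)]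

end ColumnFinite

/-! ### Twisted power series over column-finite matrices -/

namespace twistedPowerSeries

open NovikovRing

variable {A : Type*} [Ring A] {ξ : RingAut A}

/-- The `n`-th coefficient. -/
def coeffHom (ξ : RingAut A) (n : ℤ) : twistedPowerSeries ξ →+ A where
  toFun f := (f : NovikovRing ξ).coeff n
  map_zero' := rfl
  map_add' _ _ := rfl

theorem ext_coeff {f g : twistedPowerSeries ξ} (h : ∀ n, 0 ≤ n → coeffHom ξ n f = coeffHom ξ n g) :
    f = g := by
  refine Subtype.ext (NovikovRing.ext fun n => ?_)
  by_cases hn : 0 ≤ n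
  · exact h n hn
  · rw [f.2 n (not_le.1 hn), g.2 n (not_le.1 hn)]

theorem coeffHom_mul (f g : twistedPowerSeries ξ) (n : ℤ) :
    coeffHom ξ n (f * g) =
      ∑ i ∈ Finset.Icc 0 n, coeffHom ξ i f * (ξ ^ (-i)) (coeffHom ξ (n - i) g) := by
  have := coeff_mul_eq_sum (f : NovikovRing ξ) g n 0 0 f.2 g.2
  rwa [sub_zero] at this

theorem coeffHom_of_neg (f : twistedPowerSeries ξ) {n : ℤ} (hn : n < 0) : coeffHom ξ n f = 0 :=
  f.2 n hn

/-- The power series with given coefficients. -/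
noncomputable def ofCoeff (ξ : RingAut A) (c : ℤ → A) : twistedPowerSeries ξ :=
  ⟨mk (fun n => if n < 0 then 0 else c n) ⟨0, fun _ hn => if_pos hn⟩,
    fun n hn => by rw [coeff_mk, if_pos hn]⟩

theorem coeffHom_ofCoeff (c : ℤ → A) {n : ℤ} (hn : 0 ≤ n) :
    coeffHom ξ n (ofCoeff ξ c) = c n := by
  have : coeffHom ξ n (ofCoeff ξ c) = if n < 0 then 0 else c n := rfl
  rw [this, if_neg (not_lt.2 hn)]

/-- The constant series. -/
noncomputable def const (ξ : RingAut A) : A →+* twistedPowerSeries ξ where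
  toFun a := ⟨monomial 0 a, fun n hn => by rw [coeff_monomial, if_neg (by lia)]⟩
  map_one' := rfl
  map_mul' a b := Subtype.ext (NovikovRing.ext fun n => by
    rw [Subring.coe_mul, coeff_monomial_mul, coeff_monomial, coeff_monomial]
    split_ifs <;> first | lia | simp)
  map_zero' := Subtype.ext (NovikovRing.ext fun n => by
    rw [coeff_monomial, ite_self]
    rfl)
  map_add' a b := Subtype.ext (NovikovRing.ext fun n => by
    rw [Subring.coe_add, coeff_add, coeff_monomial, coeff_monomial, coeff_monomial]
    split_ifs <;> simp)

theorem coeffHom_const (a : A) (n : ℤ) : coeffHom ξ n (const ξ a) = if n = 0 then a else 0 :=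
  coeff_monomial (ξ := ξ) 0 a n

theorem augmentation_const (a : A) : augmentation ξ (const ξ a) = a :=
  (coeffHom_const a 0).trans (if_pos rfl)

theorem coeffHom_const_mul (a : A) (f : twistedPowerSeries ξ) (n : ℤ) :
    coeffHom ξ n (const ξ a * f) = a * coeffHom ξ n f := by
  have := coeff_monomial_mul 0 a (f : NovikovRing ξ) n
  rw [neg_zero, zpow_zero, sub_zero] at this
  exact this

theorem coeffHom_mul_const (a : A) (f : twistedPowerSeries ξ) (n : ℤ) :
    coeffHom ξ n (f * const ξ a) = coeffHom ξ n f * (ξ ^ (-n)) a := by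
  have := coeff_mul_monomial 0 a (f : NovikovRing ξ) n
  rw [sub_zero] at this
  exact this

theorem const_mul_z (a : A) : const ξ a * z ξ = z ξ * const ξ (ξ a) :=
  Subtype.ext (monomial_zero_mul_z a)

theorem augmentation_z : augmentation ξ (z ξ) = 0 := by
  rw [augmentation_apply]
  exact (coeff_monomial 1 1 0).trans (if_neg (by lia))

end twistedPowerSeries

open twistedPowerSeries

/-! ### Finite corners of power series with column-finite coefficients. -/

namespace ColumnFinite

variable {A : Type*} [Ring A] {ξ : RingAut A}

/-- The `(i, j)` entry of a power series with column-finite matrices as coefficients. -/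
noncomputable def seriesEntry (ξ : RingAut A) (i j : ℕ) :
    twistedPowerSeries (mapAut ξ) →+ twistedPowerSeries ξ where
  toFun f := ofCoeff ξ fun n => entry i j (coeffHom (mapAut ξ) n f)
  map_zero' := ext_coeff fun n hn => by rw [coeffHom_ofCoeff _ hn]; rfl
  map_add' f g := ext_coeff fun n hn => by
    rw [map_add, coeffHom_ofCoeff _ hn, coeffHom_ofCoeff _ hn, coeffHom_ofCoeff _ hn, map_add,
      map_add]

theorem coeffHom_seriesEntry (i j : ℕ) (f : twistedPowerSeries (mapAut ξ)) {n : ℤ} (hn : 0 ≤ n) :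
    coeffHom ξ n (seriesEntry ξ i j f) = entry i j (coeffHom (mapAut ξ) n f) :=
  coeffHom_ofCoeff _ hn

theorem seriesEntry_const (i j : ℕ) (X : ColumnFinite A) :
    seriesEntry ξ i j (const (mapAut ξ) X) = const ξ (entry i j X) := by
  refine ext_coeff fun n hn => ?_
  rw [coeffHom_seriesEntry _ _ _ hn, coeffHom_const, coeffHom_const]
  split_ifs <;> simp

/-- The inserted projection bounds the summation index uniformly in all coefficients; a plain
product of such series admits no uniform bound. -/
theorem seriesEntry_mul (i j m : ℕ) (f g : twistedPowerSeries (mapAut ξ)) :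
    seriesEntry ξ i j (f * const (mapAut ξ) (proj m) * g) =
      ∑ k ∈ Finset.range m, seriesEntry ξ i k f * seriesEntry ξ k j g := by
  refine ext_coeff fun n hn => ?_
  rw [coeffHom_seriesEntry _ _ _ hn, coeffHom_mul, map_sum, map_sum]
  simp only [coeffHom_mul]
  rw [Finset.sum_comm]
  refine Finset.sum_congr rfl fun l hl => ?_
  rw [Finset.mem_Icc] at hl
  rw [← coeffHom_mul, coeffHom_mul_const, ← map_zpow, mapAut_proj, mul_assoc,
    entry_mul _ _ _ _ m fun k hk => by rw [entry_proj_mul, if_neg (by lia)]]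
  refine Finset.sum_congr rfl fun k hk => ?_
  rw [entry_proj_mul, if_pos (Finset.mem_range.1 hk), entry_mapAut,
    coeffHom_seriesEntry _ _ _ hl.1, coeffHom_seriesEntry _ _ _ (by lia)]

variable {κ : Type} [Fintype κ] [DecidableEq κ]

/-- The upper left corner of a matrix of power series of column-finite matrices. -/
noncomputable def corner (m m' : ℕ) (X : Matrix κ κ (twistedPowerSeries (mapAut ξ))) :
    Matrix (κ × Fin m) (κ × Fin m') (twistedPowerSeries ξ) :=
  Matrix.of fun p q => seriesEntry ξ p.2 q.2 (X p.1 q.1)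

/-- The projections on column-finite matrices with entries in a matrix ring. -/
noncomputable def matProj (κ : Type) [Fintype κ] [DecidableEq κ] (m : ℕ) :
    Matrix κ κ (ColumnFinite A) := Matrix.diagonal fun _ => proj m

/-- The projections on power series of column-finite matrices with entries in a matrix ring. -/
noncomputable def seriesProj (ξ : RingAut A) (κ : Type) [Fintype κ] [DecidableEq κ] (m : ℕ) :
    Matrix κ κ (twistedPowerSeries (mapAut ξ)) :=
  Matrix.diagonal fun _ => const (mapAut ξ) (proj m)

/-- The inclusion of the constant series. -/
noncomputable def matConst (ξ : RingAut A) (κ : Type) [Fintype κ] [DecidableEq κ] :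
    Matrix κ κ (ColumnFinite A) →+* Matrix κ κ (twistedPowerSeries (mapAut ξ)) :=
  (const (mapAut ξ)).mapMatrix

theorem matConst_matProj (m : ℕ) : matConst ξ κ (matProj κ m) = seriesProj ξ κ m := by
  rw [matConst, RingHom.mapMatrix_apply, matProj, Matrix.diagonal_map (map_zero _)]
  rfl

theorem matProj_mul (a b : ℕ) (h : a ≤ b) :
    matProj κ b * matProj κ a = (matProj κ a : Matrix κ κ (ColumnFinite A)) := by
  simp only [matProj, Matrix.diagonal_mul_diagonal, proj_mul_proj a b h]

theorem seriesProj_mul (a b : ℕ) (h : a ≤ b) :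
    seriesProj ξ κ b * seriesProj ξ κ a = seriesProj ξ κ a := by
  rw [← matConst_matProj, ← matConst_matProj, ← map_mul, matProj_mul a b h]

theorem matProj_fixed_iff (m : ℕ) (X : Matrix κ κ (ColumnFinite A)) :
    matProj κ m * X = X ↔ ∀ k l, proj m * X k l = X k l := by
  rw [← Matrix.ext_iff]
  simp [matProj, Matrix.diagonal_mul]

theorem exists_fixed_matrix (X : Matrix κ κ (ColumnFinite A)) (h : ∀ k l, FinRows proj (X k l)) :
    FinRows (matProj κ) X := by
  choose f hf using h
  refine ⟨Finset.univ.sup fun k => Finset.univ.sup fun l => f k l, ?_⟩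
  rw [matProj_fixed_iff]
  intro k l
  refine fixed_mono proj_mul_proj ?_ (hf k l)
  exact (Finset.le_sup (f := fun l => f k l) (Finset.mem_univ l)).trans
    (Finset.le_sup (f := fun k => Finset.univ.sup fun l => f k l) (Finset.mem_univ k))

theorem colBdd_matrix (X : Matrix κ κ (ColumnFinite A)) : ColBdd (matProj κ) X := by
  intro m
  refine exists_fixed_matrix _ fun k l => ?_
  rw [matProj, Matrix.mul_diagonal]
  exact colBdd _ m

theorem _root_.FinRows.matConst {X : Matrix κ κ (ColumnFinite A)} (h : FinRows (matProj κ) X) :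
    FinRows (seriesProj ξ κ) (matConst ξ κ X) := by
  obtain ⟨m, hm⟩ := h
  exact ⟨m, by rw [← matConst_matProj, ← map_mul, hm]⟩

theorem _root_.ColBdd.matConst (X : Matrix κ κ (ColumnFinite A)) :
    ColBdd (seriesProj ξ κ) (matConst ξ κ X) := by
  intro m
  obtain ⟨m', hm'⟩ := colBdd_matrix X m
  exact ⟨m', by rw [← matConst_matProj, ← matConst_matProj, ← map_mul, ← map_mul, hm']⟩

theorem corner_mul (m m' m'' : ℕ) (X Y : Matrix κ κ (twistedPowerSeries (mapAut ξ))) :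
    corner m m'' (X * seriesProj ξ κ m' * Y) = corner m m' X * corner m' m'' Y := by
  ext p q
  have h : (X * seriesProj ξ κ m' * Y) p.1 q.1 =
      ∑ k, X p.1 k * const (mapAut ξ) (proj m') * Y k q.1 := by
    rw [Matrix.mul_apply]
    simp only [seriesProj, Matrix.mul_diagonal]
  simp only [corner, Matrix.of_apply, Matrix.mul_apply (M := Matrix.of _), h, map_sum,
    seriesEntry_mul, Fintype.sum_prod_type, Finset.sum_range]

omit [Fintype κ] [DecidableEq κ] in
theorem corner_add (m m' : ℕ) (X Y : Matrix κ κ (twistedPowerSeries (mapAut ξ))) :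
    corner m m' (X + Y) = corner m m' X + corner m m' Y := by
  ext p q
  simp [corner]

omit [Fintype κ] in
theorem corner_one (m : ℕ) :
    corner m m (1 : Matrix κ κ (twistedPowerSeries (mapAut ξ))) = 1 := by
  ext ⟨k, i⟩ ⟨l, j⟩
  simp only [corner, Matrix.of_apply, Matrix.one_apply, Prod.mk.injEq]
  by_cases h : k = l
  · rw [if_pos h, ← map_one (const (mapAut ξ)), seriesEntry_const, entry_one]
    simp only [Fin.ext_iff, h, true_and]
    split_ifs <;> simp
  · rw [if_neg h, map_zero, if_neg (by tauto)]

theorem corner_mul_proj (m m' : ℕ) (X : Matrix κ κ (twistedPowerSeries (mapAut ξ))) :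
    corner m m' (X * seriesProj ξ κ m') = corner m m' X := by
  rw [← mul_one (X * seriesProj ξ κ m'), corner_mul, corner_one, Matrix.mul_one]

end ColumnFinite

namespace ColumnFinite

variable {A V : Type*} [Ring A] [CommGroup V] {ξ : RingAut A} {κ : Type} [Fintype κ]
  [DecidableEq κ]

/-! ### The determinant of invertible operators of the form `1 + (finitely many rows)` -/

/-- Since `Y` differs from `1` only in the first `m` rows, it preserves the span of the first `m`
coordinates: `e Y e = Y e` for the projection `e`. Nothing is needed of `X`. -/
theorem corner_mul_of_fixed {m : ℕ} (X : Matrix κ κ (twistedPowerSeries (mapAut ξ)))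
    {Y : Matrix κ κ (twistedPowerSeries (mapAut ξ))} (hY : seriesProj ξ κ m * (Y - 1) = Y - 1) :
    corner m m (X * Y) = corner m m X * corner m m Y := by
  have h : seriesProj ξ κ m * Y * seriesProj ξ κ m = Y * seriesProj ξ κ m := by
    have h1 : Y = 1 + (Y - 1) := by abel
    rw [h1, mul_add, hY, mul_one, add_mul, add_mul, one_mul, seriesProj_mul m m le_rfl]
  rw [← corner_mul, ← corner_mul_proj, mul_assoc X, ← h, ← corner_mul_proj m m (_ * _ * Y)]
  simp only [mul_assoc]

theorem fixed_inverse {m : ℕ} {X Y : Matrix κ κ (twistedPowerSeries (mapAut ξ))}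
    (hX : seriesProj ξ κ m * (X - 1) = X - 1) (h : X * Y = 1) :
    seriesProj ξ κ m * (Y - 1) = Y - 1 := by
  have : Y - 1 = -((X - 1) * Y) := by rw [sub_mul, h, one_mul, neg_sub]
  rw [this, mul_neg, ← mul_assoc, hX]

theorem isUnit_corner {m : ℕ} {X : Matrix κ κ (twistedPowerSeries (mapAut ξ))} (h : IsUnit X)
    (hX : seriesProj ξ κ m * (X - 1) = X - 1) : IsUnit (corner m m X) := by
  obtain ⟨⟨X, Y, k, k'⟩, rfl⟩ := h
  refine isUnit_iff_exists.2 ⟨corner m m Y, ?_, ?_⟩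
  · rw [← corner_mul_of_fixed X (fixed_inverse hX k), k, corner_one]
  · rw [← corner_mul_of_fixed Y hX, k', corner_one]

/-- Truncation turns `P` and `Q` into finite rectangular blocks over `A_ξ[[z]]`, to which
`extDet_comm` applies. -/
theorem extDet_corner_comm {d : twistedPowerSeries ξ → V} (H : IsLocalDet (augmentation ξ) d)
    {m m' : ℕ} {P Q : Matrix κ κ (twistedPowerSeries (mapAut ξ))}
    (hP : seriesProj ξ κ m' * (P * seriesProj ξ κ m) = P * seriesProj ξ κ m)
    (hQ : seriesProj ξ κ m * Q = Q) (h : IsUnit (1 + P * Q)) (h' : IsUnit (1 + Q * P)) :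
    LocalDet.extDet (augmentation ξ) d (const ξ) (corner m' m' (1 + P * Q)) =
      LocalDet.extDet (augmentation ξ) d (const ξ) (corner m m (1 + Q * P)) := by
  have u1 := isUnit_corner h (m := m') (by
    rw [add_sub_cancel_left, ← hQ, ← mul_assoc P, ← mul_assoc, hP])
  have u2 := isUnit_corner h' (m := m) (by rw [add_sub_cancel_left, ← mul_assoc, hQ])
  have e1 : corner m' m' (1 + P * Q) = 1 + corner m' m P * corner m m' Q := by
    rw [corner_add, corner_one, ← corner_mul, mul_assoc, hQ]
  have e2 : corner m m (1 + Q * P) = 1 + corner m m' Q * corner m' m P := by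
    rw [corner_add, corner_one, ← corner_mul, ← corner_mul_proj, mul_assoc Q, ← hP,
      ← corner_mul_proj m m (_ * _ * P)]
    simp only [mul_assoc]
  rw [e1] at u1 ⊢
  rw [e2] at u2 ⊢
  exact LocalDet.extDet_comm H augmentation_const _ _ u1 u2

open Classical in
/-- The determinant of an invertible operator which differs from `1` in finitely many rows. -/
noncomputable def finDet (d : twistedPowerSeries ξ → V)
    (X : Matrix κ κ (twistedPowerSeries (mapAut ξ))) : V :=
  if h : FinRows (seriesProj ξ κ) (X - 1) then
    LocalDet.extDet (augmentation ξ) d (const ξ) (corner h.choose h.choose X) else 1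

variable {d : twistedPowerSeries ξ → V}

/-- Independence of the size of the corner: two sizes are compared by exchanging `P = 1` and `Q = X
- 1`. -/
theorem finDet_eq (H : IsLocalDet (augmentation ξ) d) {m : ℕ}
    {X : Matrix κ κ (twistedPowerSeries (mapAut ξ))} (h : IsUnit X)
    (hX : seriesProj ξ κ m * (X - 1) = X - 1) :
    finDet d X = LocalDet.extDet (augmentation ξ) d (const ξ) (corner m m X) := by
  have key : ∀ a b : ℕ, a ≤ b → seriesProj ξ κ a * (X - 1) = X - 1 →
      LocalDet.extDet (augmentation ξ) d (const ξ) (corner b b X) =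
      LocalDet.extDet (augmentation ξ) d (const ξ) (corner a a X) := by
    intro a b hab ha
    have := extDet_corner_comm H (m' := b) (P := 1) (by rw [one_mul, seriesProj_mul a b hab]) ha
    simp only [one_mul, mul_one, add_sub_cancel] at this
    exact this h h
  have hF : FinRows (seriesProj ξ κ) (X - 1) := ⟨m, hX⟩
  rw [finDet, dif_pos hF, ← key _ _ (le_max_left hF.choose m) hF.choose_spec,
    key _ _ (le_max_right hF.choose m) hX]

theorem finDet_one (H : IsLocalDet (augmentation ξ) d) :
    finDet d (1 : Matrix κ κ (twistedPowerSeries (mapAut ξ))) = 1 := by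
  rw [finDet_eq H (m := 0) isUnit_one (by rw [sub_self, mul_zero]), corner_one,
    LocalDet.extDet_one H]

theorem finDet_mul (H : IsLocalDet (augmentation ξ) d)
    {X Y : Matrix κ κ (twistedPowerSeries (mapAut ξ))} (hX : IsUnit X) (hY : IsUnit Y)
    (fX : FinRows (seriesProj ξ κ) (X - 1)) (fY : FinRows (seriesProj ξ κ) (Y - 1)) :
    finDet d (X * Y) = finDet d X * finDet d Y := by
  obtain ⟨a, ha⟩ := fX
  obtain ⟨b, hb⟩ := fY
  replace ha := fixed_mono seriesProj_mul (le_max_left a b) ha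
  replace hb := fixed_mono seriesProj_mul (le_max_right a b) hb
  have hXY : seriesProj ξ κ (max a b) * (X * Y - 1) = X * Y - 1 := by
    have : X * Y - 1 = (X - 1) * Y + (Y - 1) := by rw [sub_mul, one_mul, sub_add_sub_cancel]
    rw [this, mul_add, ← mul_assoc, ha, hb]
  rw [finDet_eq H (hX.mul hY) hXY, finDet_eq H hX ha, finDet_eq H hY hb,
    corner_mul_of_fixed X hb, LocalDet.extDet_mul H augmentation_const (isUnit_corner hX ha)
      (isUnit_corner hY hb)]

theorem finDet_comm (H : IsLocalDet (augmentation ξ) d)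
    {P Q : Matrix κ κ (twistedPowerSeries (mapAut ξ))} (hP : ColBdd (seriesProj ξ κ) P)
    (hQ : FinRows (seriesProj ξ κ) Q) (h : IsUnit (1 + P * Q)) (h' : IsUnit (1 + Q * P)) :
    finDet d (1 + P * Q) = finDet d (1 + Q * P) := by
  obtain ⟨m, hm⟩ := hQ
  obtain ⟨m', hm'⟩ := hP m
  rw [finDet_eq H h (m := m') (by
      rw [add_sub_cancel_left, ← hm, ← mul_assoc P, ← mul_assoc, hm']),
    finDet_eq H h' (m := m) (by rw [add_sub_cancel_left, ← mul_assoc, hm]),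
    extDet_corner_comm H hm' hm h h']

/-- Only `U`, not `U⁻¹`, has to be column bounded; this is what allows conjugation by `1 - σ z`. -/
theorem finDet_conj (H : IsLocalDet (augmentation ξ) d)
    (U X : (Matrix κ κ (twistedPowerSeries (mapAut ξ)))ˣ)
    (hU : ColBdd (seriesProj ξ κ) (U : Matrix κ κ (twistedPowerSeries (mapAut ξ))))
    (hX : FinRows (seriesProj ξ κ) ((X : Matrix κ κ (twistedPowerSeries (mapAut ξ))) - 1)) :
    finDet d ((U * X * U⁻¹ : (Matrix κ κ (twistedPowerSeries (mapAut ξ)))ˣ) :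
      Matrix κ κ (twistedPowerSeries (mapAut ξ))) =
      finDet d (X : Matrix κ κ (twistedPowerSeries (mapAut ξ))) := by
  have e1 : ((U * X * U⁻¹ : (Matrix κ κ (twistedPowerSeries (mapAut ξ)))ˣ) :
      Matrix κ κ (twistedPowerSeries (mapAut ξ))) =
      1 + U.val * ((X.val - 1) * (U⁻¹).val) := by
    rw [sub_mul, mul_sub, one_mul, Units.mul_inv, ← mul_assoc, add_sub_cancel]
    rfl
  have e2 : X.val = 1 + (X.val - 1) * (U⁻¹).val * U.val := by
    rw [mul_assoc, Units.inv_mul, mul_one, add_sub_cancel]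
  have h1 := (U * X * U⁻¹).isUnit
  have h2 := X.isUnit
  rw [e1] at h1
  rw [e2] at h2
  rw [e1, finDet_comm H hU (hX.mul_right _) h1 h2, ← e2]

/-! ### Commutators with `1 - σ z`, where `σ` is the shift -/

theorem isUnit_one_sub_shift (ξ : RingAut A) :
    IsUnit (1 - const (mapAut ξ) shift * z (mapAut ξ)) := by
  refine isUnit_of_augmentation_eq_one _ ?_
  rw [map_sub, map_one, map_mul, augmentation_z, mul_zero, sub_zero]

/-- The operator `1 - σ z`. -/
noncomputable def shiftUnit (ξ : RingAut A) (κ : Type) [Fintype κ] [DecidableEq κ] :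
    (Matrix κ κ (twistedPowerSeries (mapAut ξ)))ˣ :=
  Units.map (Matrix.scalar κ : twistedPowerSeries (mapAut ξ) →+* _).toMonoidHom
    (isUnit_one_sub_shift ξ).unit

theorem shiftUnit_val : (shiftUnit ξ κ).val =
    Matrix.diagonal fun _ => 1 - const (mapAut ξ) shift * z (mapAut ξ) := rfl

theorem colBdd_shiftUnit : ColBdd (seriesProj ξ κ) (shiftUnit ξ κ).val := by
  have e : (shiftUnit ξ κ).val = 1 - matConst ξ κ (Matrix.diagonal fun _ => shift) *
      Matrix.diagonal fun _ => z (mapAut ξ) := by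
    rw [shiftUnit_val, matConst, RingHom.mapMatrix_apply, Matrix.diagonal_map (map_zero _),
      Matrix.diagonal_mul_diagonal, ← Matrix.diagonal_one, Matrix.diagonal_sub]
  rw [e]
  refine (ColBdd.one seriesProj_mul).sub seriesProj_mul ((ColBdd.matConst _).mul fun m => ⟨m, ?_⟩)
  have h : z (mapAut ξ) * const (mapAut ξ) (proj m) = const (mapAut ξ) (proj m) * z (mapAut ξ) := by
    rw [const_mul_z, mapAut_proj]
  simp only [seriesProj, Matrix.diagonal_mul_diagonal]
  rw [h, ← mul_assoc, ← map_mul, proj_mul_proj m m le_rfl]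

/-- The operators commuting with `1 - σ z` up to finitely many rows. -/
def AlmostCommutes (X : Matrix κ κ (twistedPowerSeries (mapAut ξ))) : Prop :=
  FinRows (seriesProj ξ κ) (X * (shiftUnit ξ κ).val - (shiftUnit ξ κ).val * X)

theorem _root_.FinRows.almostCommutes {X : Matrix κ κ (twistedPowerSeries (mapAut ξ))}
    (hX : FinRows (seriesProj ξ κ) X) : AlmostCommutes X :=
  (hX.mul_right _).sub seriesProj_mul (colBdd_shiftUnit.mul_finRows hX)

theorem AlmostCommutes.add {X Y : Matrix κ κ (twistedPowerSeries (mapAut ξ))}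
    (hX : AlmostCommutes X) (hY : AlmostCommutes Y) : AlmostCommutes (X + Y) := by
  have := FinRows.add seriesProj_mul hX hY
  rw [AlmostCommutes]
  convert this using 1
  rw [add_mul, mul_add]
  abel

/-- The commutator with `1 - σ z`. -/
noncomputable def shiftCommutator (X : (Matrix κ κ (twistedPowerSeries (mapAut ξ)))ˣ) :
    (Matrix κ κ (twistedPowerSeries (mapAut ξ)))ˣ :=
  X * shiftUnit ξ κ * X⁻¹ * (shiftUnit ξ κ)⁻¹

/-- The determinant of the commutator with `1 - σ z`. -/
noncomputable def torsion (ξ : RingAut A) (d : twistedPowerSeries ξ → V)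
    (U : (Matrix κ κ (ColumnFinite A))ˣ) : V :=
  finDet d (shiftCommutator (Units.map (matConst ξ κ).toMonoidHom U)).val

theorem shiftCommutator_sub_one (X : (Matrix κ κ (twistedPowerSeries (mapAut ξ)))ˣ) :
    (shiftCommutator X).val - 1 =
      (X.val * (shiftUnit ξ κ).val - (shiftUnit ξ κ).val * X.val) * (X⁻¹).val *
        ((shiftUnit ξ κ)⁻¹).val := by
  rw [shiftCommutator, sub_mul, sub_mul, mul_assoc _ X.val, Units.mul_inv, mul_one, Units.mul_inv]
  rfl

theorem finRows_commutator {X : (Matrix κ κ (twistedPowerSeries (mapAut ξ)))ˣ}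
    (hX : AlmostCommutes X.val) :
    FinRows (seriesProj ξ κ) ((shiftCommutator X).val - 1) := by
  rw [shiftCommutator_sub_one]
  exact (FinRows.mul_right hX _).mul_right _

/-- With `S = 1 - σ z` one has `[UW, S] = U [W, S] U⁻¹ · [U, S]`, and the determinant is conjugation
invariant. -/
theorem torsion_mul (H : IsLocalDet (augmentation ξ) d) (U W : (Matrix κ κ (ColumnFinite A))ˣ)
    (hU : AlmostCommutes (matConst ξ κ U)) (hW : AlmostCommutes (matConst ξ κ W)) :
    torsion ξ d (U * W) = torsion ξ d U * torsion ξ d W := by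
  set φ := Units.map (matConst ξ κ).toMonoidHom
  have hU' := finRows_commutator (X := φ U) hU
  have hW' := finRows_commutator (X := φ W) hW
  have e : (shiftCommutator (φ (U * W))) =
      φ U * (shiftCommutator (φ W)) * (φ U)⁻¹ * (shiftCommutator (φ U)) := by
    rw [map_mul]
    simp only [shiftCommutator]
    group
  have hc := finDet_conj H (φ U) (shiftCommutator (φ W)) (ColBdd.matConst U.val) hW'
  have hf : FinRows (seriesProj ξ κ) ((φ U * (shiftCommutator (φ W)) * (φ U)⁻¹).val - 1) := by
    have : (φ U * (shiftCommutator (φ W)) * (φ U)⁻¹).val - 1 =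
        (φ U).val * (((shiftCommutator (φ W)).val - 1) * ((φ U)⁻¹).val) := by
      rw [sub_mul, mul_sub, one_mul, Units.mul_inv, ← mul_assoc]
      rfl
    rw [this]
    exact (ColBdd.matConst U.val).mul_finRows (hW'.mul_right _)
  rw [torsion, e, Units.val_mul, finDet_mul H (Units.isUnit _) (Units.isUnit _) hf hU', hc,
    mul_comm]
  rfl

/-- Here `U` and `S U⁻¹ S⁻¹`, with `S = 1 - σ z`, are separately `1` plus finitely many rows, so the
determinant of the commutator splits as that of `U` times that of `U⁻¹`. -/
theorem torsion_eq_one_of_finRows (H : IsLocalDet (augmentation ξ) d)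
    (U : (Matrix κ κ (ColumnFinite A))ˣ) (hU : FinRows (matProj κ) (U.val - 1)) :
    torsion ξ d U = 1 := by
  set φ := Units.map (matConst ξ κ).toMonoidHom with hφ
  have h1 : FinRows (seriesProj ξ κ) ((φ U).val - 1) := by
    have := hU.matConst (ξ := ξ)
    rwa [map_sub, map_one] at this
  have h2 : FinRows (seriesProj ξ κ) ((φ U)⁻¹.val - 1) := by
    obtain ⟨m, hm⟩ := h1
    exact ⟨m, fixed_inverse hm (Units.mul_inv _)⟩
  have h3 : FinRows (seriesProj ξ κ)
      ((shiftUnit ξ κ * (φ U)⁻¹ * (shiftUnit ξ κ)⁻¹).val - 1) := by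
    have : (shiftUnit ξ κ * (φ U)⁻¹ * (shiftUnit ξ κ)⁻¹).val - 1 =
        (shiftUnit ξ κ).val * (((φ U)⁻¹.val - 1) * ((shiftUnit ξ κ)⁻¹).val) := by
      rw [sub_mul, mul_sub, one_mul, Units.mul_inv, ← mul_assoc]
      rfl
    rw [this]
    exact colBdd_shiftUnit.mul_finRows (h2.mul_right _)
  have e : (shiftCommutator (φ U)) = φ U * (shiftUnit ξ κ * (φ U)⁻¹ * (shiftUnit ξ κ)⁻¹) := by
    rw [shiftCommutator]
    group
  rw [torsion, ← hφ, e, Units.val_mul, finDet_mul H (Units.isUnit _) (Units.isUnit _) h1 h3,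
    finDet_conj H _ _ colBdd_shiftUnit h2, ← finDet_mul H (Units.isUnit _) (Units.isUnit _) h1 h2,
    ← Units.val_mul, mul_inv_cancel, Units.val_one, finDet_one H]

theorem torsion_one (H : IsLocalDet (augmentation ξ) d) :
    torsion ξ d (1 : (Matrix κ κ (ColumnFinite A))ˣ) = 1 :=
  torsion_eq_one_of_finRows H 1 ⟨0, by simp⟩

/-- The relations `q N = N` and `N q = 0` pass from `N` to the error term of the commutator because
`q` commutes with `G` and `G'`. -/
theorem commutator_absorb {B : Type*} [Ring B] {N q G G' : B} (k1 : q * N = N) (k2 : N * q = 0)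
    (hG : q * G = G * q) (hG' : q * G' = G' * q) (h : G * G' = 1) :
    q * ((1 + N) * G * (1 - N) * G' - 1) = (1 + N) * G * (1 - N) * G' - 1 ∧
      ((1 + N) * G * (1 - N) * G' - 1) * q = 0 := by
  have e : (1 + N) * G * (1 - N) * G' - 1 = N - G * N * G' - N * (G * N * G') := by
    have : (1 + N) * G * (1 - N) * G' =
        G * G' + N * (G * G') - G * N * G' - N * (G * N * G') := by noncomm_ring
    rw [this, h, mul_one]
    abel
  have k3 : q * (G * N * G') = G * N * G' := by
    rw [mul_assoc G, ← mul_assoc q, hG, mul_assoc G q, ← mul_assoc q, k1]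
  have k4 : G * N * G' * q = 0 := by
    rw [mul_assoc, ← hG', ← mul_assoc, mul_assoc G, k2, mul_zero, zero_mul]
  rw [e]
  constructor
  · rw [mul_sub, mul_sub, k1, k3, ← mul_assoc q N, k1]
  · rw [sub_mul, sub_mul, k2, k4, mul_assoc N, k4, mul_zero, sub_zero, sub_zero]

/-- If `Y` is the commutator minus `1` and `q` the image of `p`, then `q Y = Y` and `Y q = 0`.
Exchanging `q` and `Y` identifies the determinant of `1 + Y` with that of `1`. -/
theorem torsion_eq_one_of_nilpotent (H : IsLocalDet (augmentation ξ) d)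
    (U : (Matrix κ κ (ColumnFinite A))ˣ) (p : Matrix κ κ (ColumnFinite A))
    (hp : Commute (matConst ξ κ p) (shiftUnit ξ κ).val) (h1 : p * (U.val - 1) = U.val - 1)
    (h2 : (U.val - 1) * p = 0) (hU : AlmostCommutes (matConst ξ κ U)) : torsion ξ d U = 1 := by
  set φ := Units.map (matConst ξ κ).toMonoidHom with hφ
  set q := matConst ξ κ p
  have hc := finRows_commutator (X := φ U) hU
  have k1 : q * ((φ U).val - 1) = (φ U).val - 1 := by
    have := congrArg (matConst ξ κ) h1
    rwa [map_mul, map_sub, map_one] at this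
  have k2 : ((φ U).val - 1) * q = 0 := by
    have := congrArg (matConst ξ κ) h2
    rwa [map_mul, map_sub, map_one, map_zero] at this
  have inv : (φ U)⁻¹.val = 1 - ((φ U).val - 1) := by
    have hn : ((φ U).val - 1) * ((φ U).val - 1) = 0 := by
      nth_rw 2 [← k1]
      rw [← mul_assoc, k2, zero_mul]
    refine (Units.eq_inv_of_mul_eq_one_right ?_).symm
    calc _ = 1 - ((φ U).val - 1) * ((φ U).val - 1) := by noncomm_ring
      _ = 1 := by rw [hn, sub_zero]
  have hp' : Commute q (shiftUnit ξ κ)⁻¹.val := hp.units_inv_right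
  generalize hN : (φ U).val - 1 = N at k1 k2 inv
  have hN' : (φ U).val = 1 + N := by rw [← hN]; abel
  obtain ⟨e1, e2⟩ := commutator_absorb k1 k2 hp.eq hp'.eq (Units.mul_inv (shiftUnit ξ κ))
  have e : (shiftCommutator (φ U)).val =
      (1 + N) * (shiftUnit ξ κ).val * (1 - N) * (shiftUnit ξ κ)⁻¹.val := by
    rw [← hN', ← inv]
    rfl
  rw [← e] at e1 e2
  have h := finDet_comm (d := d) H (ColBdd.matConst p) hc (by
      rw [e1, add_sub_cancel]
      exact Units.isUnit _) (by
      rw [e2, add_zero]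
      exact isUnit_one)
  rwa [e1, e2, add_zero, add_sub_cancel, finDet_one H] at h

end ColumnFinite

/-! ### Toeplitz operators -/

theorem FinRows.sum {B ι : Type*} [Ring B] {e : ℕ → B} (he : ∀ a b, a ≤ b → e b * e a = e a)
    (s : Finset ι) {f : ι → B} (h : ∀ i ∈ s, FinRows e (f i)) : FinRows e (∑ i ∈ s, f i) :=
  Finset.sum_induction f (FinRows e) (fun _ _ ha hb => ha.add he hb) FinRows.zero h

namespace ColumnFinite

variable {A V : Type*} [Ring A] [CommGroup V] {ξ : RingAut A} {κ : Type} [Fintype κ]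
  [DecidableEq κ]

/-- The Toeplitz operator of a Novikov series: the compression of left multiplication to the
negative powers. -/
noncomputable def toeplitz (ξ : RingAut A) : NovikovRing ξ →+ ColumnFinite A where
  toFun f := ofCols fun j => Finsupp.onFinset
    (Finset.range ((j : ℤ) - f.support_bddBelow.choose + 1).toNat)
    (fun i => (ξ ^ (-(i : ℤ))) (f.coeff (j - i))) (fun i hi => by
      rw [Finset.mem_range]
      by_contra h
      exact hi (by rw [f.support_bddBelow.choose_spec _ (by lia), map_zero]))
  map_zero' := ext_entry fun i j => by
    rw [entry_ofCols, Finsupp.onFinset_apply, NovikovRing.coeff_zero, map_zero, map_zero]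
  map_add' f g := ext_entry fun i j => by
    rw [map_add]
    simp only [entry_ofCols, Finsupp.onFinset_apply, NovikovRing.coeff_add, map_add]

theorem entry_toeplitz (f : NovikovRing ξ) (i j : ℕ) :
    entry i j (toeplitz ξ f) = (ξ ^ (-(i : ℤ))) (f.coeff (j - i)) :=
  entry_ofCols _ i j

theorem toeplitz_one : toeplitz ξ (1 : NovikovRing ξ) = 1 := by
  refine ext_entry fun i j => ?_
  rw [entry_toeplitz, entry_one, NovikovRing.coeff_one]
  split_ifs <;> first | lia | simp

/-- The matrix product lacks exactly those terms of the convolution whose intermediate index `p + i`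
is negative. As `p ≥ F`, there are none in a row with `F + i ≥ 0`. -/
theorem entry_toeplitz_mul (f g : NovikovRing ξ) (F : ℤ) (hf : ∀ n < F, f.coeff n = 0) (i j : ℕ)
    (hi : 0 ≤ F + i) :
    entry i j (toeplitz ξ f * toeplitz ξ g) = entry i j (toeplitz ξ (f * g)) := by
  obtain ⟨G, hg⟩ := g.support_bddBelow
  rw [entry_mul _ _ i j (j - G + 1).toNat, entry_toeplitz,
    NovikovRing.coeff_mul_eq_sum f g _ F G hf hg, map_sum]
  · refine (Finset.sum_of_injOn (fun p : ℤ => (p + i).toNat) ?_ ?_ ?_ ?_).symm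
    · intro p hp q hq h
      simp only [Finset.coe_Icc, Set.mem_Icc] at hp hq h
      lia
    · intro p hp
      simp only [Finset.coe_Icc, Set.mem_Icc, Finset.coe_range, Set.mem_Iio] at hp ⊢
      lia
    · intro k hk hk'
      rw [entry_toeplitz, hf, map_zero, zero_mul]
      by_contra h
      refine hk' ⟨k - i, ?_, by simp⟩
      simp only [Finset.mem_range, Finset.coe_Icc, Set.mem_Icc] at hk ⊢
      lia
    · intro p hp
      rw [Finset.mem_Icc] at hp
      have h1 : (((p + i).toNat : ℕ) : ℤ) = p + i := by lia
      rw [entry_toeplitz, entry_toeplitz, h1, map_mul, ← RingAut.mul_apply, ← _root_.zpow_add]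
      congr 3
      · ring_nf
      · ring_nf
      · ring_nf
  · intro k hk
    rw [entry_toeplitz, hg, map_zero]
    lia

theorem finRows_toeplitz_mul (f g : NovikovRing ξ) :
    FinRows proj (toeplitz ξ f * toeplitz ξ g - toeplitz ξ (f * g)) := by
  obtain ⟨F, hF⟩ := f.support_bddBelow
  refine ⟨(-F).toNat, (finRows_iff _ _).2 fun i j hi => ?_⟩
  rw [map_sub, entry_toeplitz_mul f g F hF i j (by lia), sub_self]

/-- For a power series `F = 0`, so no row is exceptional. Hence invertible power series have
invertible Toeplitz operators. -/
theorem toeplitz_mul_of_mem {f : NovikovRing ξ} (hf : f ∈ twistedPowerSeries ξ)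
    (g : NovikovRing ξ) : toeplitz ξ (f * g) = toeplitz ξ f * toeplitz ξ g :=
  ext_entry fun i j => (entry_toeplitz_mul f g 0 hf i j (by lia)).symm

/-- Twisted constancy along diagonals: `ξ⁻¹` of the entry at `(i - 1, j)` is the entry at `(i, j +
1)`. Only row `0`, to which the left shift contributes nothing, survives. -/
theorem proj_mul_toeplitz_commutator (f : NovikovRing ξ) :
    proj 1 * (shift * (mapAut ξ)⁻¹ (toeplitz ξ f) - toeplitz ξ f * shift) =
      shift * (mapAut ξ)⁻¹ (toeplitz ξ f) - toeplitz ξ f * shift := by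
  rw [finRows_iff]
  intro i j hi
  rw [map_sub, entry_shift_mul, if_neg (by lia), entry_mul_shift, ← _root_.zpow_neg_one,
    entry_mapAut_zpow, entry_toeplitz, entry_toeplitz, ← RingAut.mul_apply, ← _root_.zpow_add,
    sub_eq_zero]
  congr 2 <;> lia

/-- The entrywise Toeplitz operator of a matrix. -/
noncomputable def matToeplitz (x : Matrix κ κ (NovikovRing ξ)) : Matrix κ κ (ColumnFinite A) :=
  x.map (toeplitz ξ)

omit [Fintype κ] in
theorem matToeplitz_one : matToeplitz (1 : Matrix κ κ (NovikovRing ξ)) = 1 :=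
  Matrix.map_one _ (map_zero _) toeplitz_one

theorem finRows_matToeplitz_mul (x y : Matrix κ κ (NovikovRing ξ)) :
    FinRows (matProj κ) (matToeplitz x * matToeplitz y - matToeplitz (x * y)) := by
  refine exists_fixed_matrix _ fun k l => ?_
  simp only [matToeplitz, Matrix.sub_apply, Matrix.mul_apply, Matrix.map_apply, map_sum]
  rw [← Finset.sum_sub_distrib]
  exact FinRows.sum proj_mul_proj _ fun i _ => finRows_toeplitz_mul _ _

/-- Moving `z` to the right past a constant applies `ξ⁻¹` to it, so the commutator carries the
twisted difference studied in `proj_mul_toeplitz_commutator`. -/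
theorem const_commutator (X : ColumnFinite A) :
    const (mapAut ξ) X * (1 - const (mapAut ξ) shift * z (mapAut ξ)) -
      (1 - const (mapAut ξ) shift * z (mapAut ξ)) * const (mapAut ξ) X =
      const (mapAut ξ) (shift * (mapAut ξ)⁻¹ X - X * shift) * z (mapAut ξ) := by
  have h : z (mapAut ξ) * const (mapAut ξ) X =
      const (mapAut ξ) ((mapAut ξ)⁻¹ X) * z (mapAut ξ) := by
    rw [const_mul_z]
    exact congrArg (fun Y => z (mapAut ξ) * const (mapAut ξ) Y)
      (RingEquiv.apply_symm_apply (mapAut ξ) X).symm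
  calc _ = const (mapAut ξ) shift * (z (mapAut ξ) * const (mapAut ξ) X) -
        const (mapAut ξ) X * const (mapAut ξ) shift * z (mapAut ξ) := by noncomm_ring
    _ = _ := by
      rw [h, map_sub, map_mul, map_mul, sub_mul]
      simp only [mul_assoc]

theorem seriesProj_one_mul_commutator (x : Matrix κ κ (NovikovRing ξ)) :
    seriesProj ξ κ 1 * (matConst ξ κ (matToeplitz x) * (shiftUnit ξ κ).val -
      (shiftUnit ξ κ).val * matConst ξ κ (matToeplitz x)) =
    matConst ξ κ (matToeplitz x) * (shiftUnit ξ κ).val -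
      (shiftUnit ξ κ).val * matConst ξ κ (matToeplitz x) := by
  set Y : Matrix κ κ (ColumnFinite A) := Matrix.of fun k l =>
    shift * (mapAut ξ)⁻¹ (toeplitz ξ (x k l)) - toeplitz ξ (x k l) * shift with hY
  have e : matConst ξ κ (matToeplitz x) * (shiftUnit ξ κ).val -
      (shiftUnit ξ κ).val * matConst ξ κ (matToeplitz x) =
      matConst ξ κ Y * Matrix.diagonal fun _ => z (mapAut ξ) := by
    ext1 k l
    rw [shiftUnit_val, Matrix.sub_apply, Matrix.mul_diagonal, Matrix.diagonal_mul,
      Matrix.mul_diagonal]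
    exact const_commutator _
  have hY1 : matProj κ 1 * Y = Y := by
    rw [matProj_fixed_iff]
    intro k l
    rw [hY, Matrix.of_apply]
    exact proj_mul_toeplitz_commutator _
  rw [e, ← mul_assoc, ← matConst_matProj, ← map_mul, hY1]

theorem almostCommutes_matToeplitz (x : Matrix κ κ (NovikovRing ξ)) :
    AlmostCommutes (matConst ξ κ (matToeplitz x)) :=
  ⟨1, seriesProj_one_mul_commutator x⟩

/-- `X` is a lift of the matrix `x` to operators: it is the Toeplitz operator of `x` up to finitely
many rows. -/
def IsLift (x : Matrix κ κ (NovikovRing ξ)) (X : Matrix κ κ (ColumnFinite A)) : Prop :=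
  FinRows (matProj κ) (X - matToeplitz x)

theorem isLift_matToeplitz (x : Matrix κ κ (NovikovRing ξ)) : IsLift x (matToeplitz x) := by
  rw [IsLift, sub_self]
  exact FinRows.zero

theorem IsLift.mul {x y : Matrix κ κ (NovikovRing ξ)} {X Y : Matrix κ κ (ColumnFinite A)}
    (hX : IsLift x X) (hY : IsLift y Y) : IsLift (x * y) (X * Y) := by
  have e : X * Y - matToeplitz (x * y) = X * (Y - matToeplitz y) +
      (X - matToeplitz x) * matToeplitz y +
      (matToeplitz x * matToeplitz y - matToeplitz (x * y)) := by
    rw [mul_sub, sub_mul]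
    abel
  rw [IsLift, e]
  exact (((colBdd_matrix X).mul_finRows hY).add matProj_mul (hX.mul_right _)).add matProj_mul
    (finRows_matToeplitz_mul x y)

theorem isLift_one : IsLift (1 : Matrix κ κ (NovikovRing ξ)) (1 : Matrix κ κ (ColumnFinite A)) := by
  have := isLift_matToeplitz (1 : Matrix κ κ (NovikovRing ξ))
  rwa [matToeplitz_one] at this

theorem IsLift.inv {x y : Matrix κ κ (NovikovRing ξ)} {X Y : Matrix κ κ (ColumnFinite A)}
    (hX : IsLift x X) (hxy : x * y = 1) (hYX : Y * X = 1) : IsLift y Y := by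
  have h := hX.mul (isLift_matToeplitz y)
  rw [hxy, IsLift, matToeplitz_one] at h
  have e : Y - matToeplitz y = -(Y * (X * matToeplitz y - 1)) := by
    rw [mul_sub, ← mul_assoc, hYX, one_mul, mul_one, neg_sub]
  rw [IsLift, e]
  exact ((colBdd_matrix Y).mul_finRows h).neg

theorem IsLift.almostCommutes {x : Matrix κ κ (NovikovRing ξ)} {X : Matrix κ κ (ColumnFinite A)}
    (hX : IsLift x X) : AlmostCommutes (matConst ξ κ X) := by
  have e : matConst ξ κ X = matConst ξ κ (X - matToeplitz x) + matConst ξ κ (matToeplitz x) := by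
    rw [← map_add, sub_add_cancel]
  rw [e]
  exact (FinRows.matConst hX).almostCommutes.add (almostCommutes_matToeplitz x)

end ColumnFinite

/-! ### Block matrices of units -/

namespace BlockUnit

variable {B : Type*} [Ring B] {κ : Type} [Fintype κ] [DecidableEq κ]

/-- The unit `x ⊕ y`. -/
def diag (x y : (Matrix κ κ B)ˣ) : (Matrix (κ ⊕ κ) (κ ⊕ κ) B)ˣ where
  val := fromBlocks x 0 0 y
  inv := fromBlocks (x⁻¹).val 0 0 (y⁻¹).val
  val_inv := by simp [fromBlocks_multiply]
  inv_val := by simp [fromBlocks_multiply]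

theorem diag_mul (x y x' y' : (Matrix κ κ B)ˣ) :
    diag x y * diag x' y' = diag (x * x') (y * y') := by
  refine Units.ext ?_
  rw [Units.val_mul]
  simp [diag, fromBlocks_multiply]

theorem diag_one : diag (1 : (Matrix κ κ B)ˣ) 1 = 1 :=
  Units.ext fromBlocks_one

/-- The inclusion `x ↦ x ⊕ 1`. -/
def stabHom : (Matrix κ κ B)ˣ →* (Matrix (κ ⊕ κ) (κ ⊕ κ) B)ˣ where
  toFun x := diag x 1
  map_one' := diag_one
  map_mul' x y := by rw [diag_mul, one_mul]

/-- The block unipotent upper triangular unit. -/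
def upper (a : Matrix κ κ B) : (Matrix (κ ⊕ κ) (κ ⊕ κ) B)ˣ where
  val := fromBlocks 1 a 0 1
  inv := fromBlocks 1 (-a) 0 1
  val_inv := by simp [fromBlocks_multiply]
  inv_val := by simp [fromBlocks_multiply]

/-- The block unipotent lower triangular unit. -/
def lower (a : Matrix κ κ B) : (Matrix (κ ⊕ κ) (κ ⊕ κ) B)ˣ where
  val := fromBlocks 1 0 a 1
  inv := fromBlocks 1 0 (-a) 1
  val_inv := by simp [fromBlocks_multiply]
  inv_val := by simp [fromBlocks_multiply]

variable (B κ) in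
/-- The block rotation. -/
def rot : (Matrix (κ ⊕ κ) (κ ⊕ κ) B)ˣ where
  val := fromBlocks 0 (-1) 1 0
  inv := fromBlocks 0 1 (-1) 0
  val_inv := by simp [fromBlocks_multiply]
  inv_val := by simp [fromBlocks_multiply]

/-- Whitehead's lemma. The rotation is kept whole because its entries are integers, so it commutes
exactly with `1 - σ z`. -/
theorem diag_inv_eq (x : (Matrix κ κ B)ˣ) :
    diag x x⁻¹ = upper x.val * lower (-(x⁻¹).val) * upper x.val * rot B κ := by
  refine Units.ext ?_
  simp only [Units.val_mul]
  simp [diag, upper, lower, rot, fromBlocks_multiply]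

theorem stabHom_commutator (x y : (Matrix κ κ B)ˣ) :
    stabHom (x * y * x⁻¹ * y⁻¹) =
      diag (x * y) (x * y)⁻¹ * diag x⁻¹ (x⁻¹)⁻¹ * diag y⁻¹ (y⁻¹)⁻¹ := by
  rw [diag_mul, diag_mul]
  change diag _ _ = _
  congr 1
  group

end BlockUnit

/-! ### Commutators lift to operators of trivial torsion. -/

namespace ColumnFinite

open BlockUnit

variable {A V : Type*} [Ring A] [CommGroup V] {ξ : RingAut A} {κ : Type} [Fintype κ]
  [DecidableEq κ] {d : twistedPowerSeries ξ → V}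

/-- The invertible matrices over the Novikov ring which lift to invertible operators of trivial
torsion. -/
noncomputable def trivialTorsion (κ : Type) [Fintype κ] [DecidableEq κ]
    (H : IsLocalDet (augmentation ξ) d) :
    Subgroup (Matrix κ κ (NovikovRing ξ))ˣ where
  carrier := {x | ∃ U : (Matrix κ κ (ColumnFinite A))ˣ, IsLift x.val U.val ∧ torsion ξ d U = 1}
  one_mem' := ⟨1, isLift_one, torsion_one H⟩
  mul_mem' := by
    rintro x y ⟨U, hU, tU⟩ ⟨W, hW, tW⟩
    exact ⟨U * W, hU.mul hW, by
      rw [torsion_mul H U W hU.almostCommutes hW.almostCommutes, tU, tW, one_mul]⟩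
  inv_mem' := by
    rintro x ⟨U, hU, tU⟩
    have hU' : IsLift (x⁻¹).val (U⁻¹).val := hU.inv (Units.mul_inv x) (Units.inv_mul U)
    refine ⟨U⁻¹, hU', ?_⟩
    have := torsion_mul H U U⁻¹ hU.almostCommutes hU'.almostCommutes
    rwa [mul_inv_cancel, torsion_one H, tU, one_mul, eq_comm] at this

/-- Two invertible lifts of `x` differ by a unit of the form `1 +` finitely many rows, whose torsion
is trivial; so the choice of lift does not matter. -/
theorem torsion_eq_one_of_isLift (H : IsLocalDet (augmentation ξ) d)
    {x : (Matrix κ κ (NovikovRing ξ))ˣ} (hx : x ∈ trivialTorsion κ H)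
    {U : (Matrix κ κ (ColumnFinite A))ˣ} (hU : IsLift x.val U.val) : torsion ξ d U = 1 := by
  obtain ⟨W, hW, tW⟩ := hx
  have h1 : IsLift (1 : Matrix κ κ (NovikovRing ξ)) (U * W⁻¹).val := by
    have := hU.mul (hW.inv (Units.mul_inv x) (Units.inv_mul W))
    rwa [Units.mul_inv] at this
  have h2 : torsion ξ d (U * W⁻¹) = 1 := by
    refine torsion_eq_one_of_finRows H _ ?_
    rwa [IsLift, matToeplitz_one] at h1
  have h3 := torsion_mul H (U * W⁻¹) W h1.almostCommutes hW.almostCommutes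
  rwa [inv_mul_cancel_right, h2, tW, one_mul] at h3

omit [Fintype κ] [DecidableEq κ] in
theorem matToeplitz_fromBlocks (a b c e : Matrix κ κ (NovikovRing ξ)) :
    matToeplitz (fromBlocks a b c e) =
      fromBlocks (matToeplitz a) (matToeplitz b) (matToeplitz c) (matToeplitz e) :=
  fromBlocks_map _ _ _ _ _

omit [Fintype κ] [DecidableEq κ] in
theorem matToeplitz_zero : matToeplitz (0 : Matrix κ κ (NovikovRing ξ)) = 0 :=
  Matrix.map_zero _ (map_zero _)

/-- Integer multiples of `1` are central, so an integral matrix commutes with a scalar one even over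
a noncommutative ring. -/
theorem commute_shiftUnit (p : κ → κ → ℤ) :
    Commute (matConst ξ κ (Matrix.of fun i j => ((p i j : ℤ) : ColumnFinite A)))
      (shiftUnit ξ κ).val := by
  refine Matrix.ext fun i j => ?_
  rw [shiftUnit_val, Matrix.mul_diagonal, Matrix.diagonal_mul]
  have : matConst ξ κ (Matrix.of fun i j => ((p i j : ℤ) : ColumnFinite A)) i j = (p i j : ℤ) :=
    map_intCast (const (mapAut ξ)) _
  rw [this]
  exact Int.cast_commute _ _

theorem upper_mem_trivialTorsion (H : IsLocalDet (augmentation ξ) d)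
    (a : Matrix κ κ (NovikovRing ξ)) : upper a ∈ trivialTorsion (κ ⊕ κ) H := by
  have hl : IsLift (upper a).val (upper (matToeplitz a)).val := by
    have := isLift_matToeplitz (upper a).val
    simpa only [upper, matToeplitz_fromBlocks, matToeplitz_one, matToeplitz_zero] using this
  refine ⟨upper (matToeplitz a), hl, ?_⟩
  have e : (upper (matToeplitz a)).val - 1 = fromBlocks 0 (matToeplitz a) 0 0 := by
    change fromBlocks _ _ _ _ - _ = _
    rw [← fromBlocks_one, sub_eq_iff_eq_add, fromBlocks_add]
    simp
  -- The projection to the first block fixes the strictly upper part from the left and kills it from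
  -- the right.
  refine torsion_eq_one_of_nilpotent H _ (fromBlocks 1 0 0 0) ?_ ?_ ?_ hl.almostCommutes
  · have : (fromBlocks 1 0 0 0 : Matrix (κ ⊕ κ) (κ ⊕ κ) (ColumnFinite A)) = Matrix.of fun i j =>
        (((fromBlocks 1 0 0 0 : Matrix (κ ⊕ κ) (κ ⊕ κ) ℤ) i j : ℤ) : ColumnFinite A) := by
      ext (i | i) (j | j) : 2 <;> simp [Matrix.one_apply]
    rw [this]
    exact commute_shiftUnit _
  · rw [e, fromBlocks_multiply]
    simp
  · rw [e, fromBlocks_multiply]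
    simp

theorem lower_mem_trivialTorsion (H : IsLocalDet (augmentation ξ) d)
    (a : Matrix κ κ (NovikovRing ξ)) : lower a ∈ trivialTorsion (κ ⊕ κ) H := by
  have hl : IsLift (lower a).val (lower (matToeplitz a)).val := by
    have := isLift_matToeplitz (lower a).val
    simpa only [lower, matToeplitz_fromBlocks, matToeplitz_one, matToeplitz_zero] using this
  refine ⟨lower (matToeplitz a), hl, ?_⟩
  have e : (lower (matToeplitz a)).val - 1 = fromBlocks 0 0 (matToeplitz a) 0 := by
    change fromBlocks _ _ _ _ - _ = _
    rw [← fromBlocks_one, sub_eq_iff_eq_add, fromBlocks_add]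
    simp
  refine torsion_eq_one_of_nilpotent H _ (fromBlocks 0 0 0 1) ?_ ?_ ?_ hl.almostCommutes
  · have : (fromBlocks 0 0 0 1 : Matrix (κ ⊕ κ) (κ ⊕ κ) (ColumnFinite A)) = Matrix.of fun i j =>
        (((fromBlocks 0 0 0 1 : Matrix (κ ⊕ κ) (κ ⊕ κ) ℤ) i j : ℤ) : ColumnFinite A) := by
      ext (i | i) (j | j) : 2 <;> simp [Matrix.one_apply]
    rw [this]
    exact commute_shiftUnit _
  · rw [e, fromBlocks_multiply]
    simp
  · rw [e, fromBlocks_multiply]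
    simp

theorem rot_mem_trivialTorsion (H : IsLocalDet (augmentation ξ) d) :
    rot (NovikovRing ξ) κ ∈ trivialTorsion (κ ⊕ κ) H := by
  have hl : IsLift (rot (NovikovRing ξ) κ).val (rot (ColumnFinite A) κ).val := by
    have := isLift_matToeplitz (rot (NovikovRing ξ) κ).val
    have e : matToeplitz (-1 : Matrix κ κ (NovikovRing ξ)) = -1 := by
      rw [← matToeplitz_one]
      ext1 i j
      exact map_neg (toeplitz ξ) ((1 : Matrix κ κ (NovikovRing ξ)) i j)
    simpa only [rot, matToeplitz_fromBlocks, matToeplitz_one, matToeplitz_zero, e] using this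
  refine ⟨rot (ColumnFinite A) κ, hl, ?_⟩
  have hc : Commute (matConst ξ (κ ⊕ κ) (rot (ColumnFinite A) κ).val)
      (shiftUnit ξ (κ ⊕ κ)).val := by
    have : (rot (ColumnFinite A) κ).val = Matrix.of fun i j =>
        (((fromBlocks 0 (-1) 1 0 : Matrix (κ ⊕ κ) (κ ⊕ κ) ℤ) i j : ℤ) : ColumnFinite A) := by
      ext (i | i) (j | j) : 2 <;> simp [Matrix.one_apply, rot]
    rw [this]
    exact commute_shiftUnit _
  have h1 : shiftCommutator (Units.map (matConst ξ (κ ⊕ κ)).toMonoidHom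
      (rot (ColumnFinite A) κ)) = 1 := by
    have : Commute (Units.map (matConst ξ (κ ⊕ κ)).toMonoidHom (rot (ColumnFinite A) κ))
        (shiftUnit ξ (κ ⊕ κ)) := Units.ext hc
    rw [shiftCommutator, this.eq, mul_inv_cancel_right, mul_inv_cancel]
  rw [torsion, h1, Units.val_one, finDet_one H]

theorem diag_inv_mem_trivialTorsion (H : IsLocalDet (augmentation ξ) d)
    (x : (Matrix κ κ (NovikovRing ξ))ˣ) : diag x x⁻¹ ∈ trivialTorsion (κ ⊕ κ) H := by
  rw [diag_inv_eq]
  exact mul_mem (mul_mem (mul_mem (upper_mem_trivialTorsion H _) (lower_mem_trivialTorsion H _))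
    (upper_mem_trivialTorsion H _)) (rot_mem_trivialTorsion H)

/-- Neither `x` nor `y` is assumed to have an invertible lift, but every `w ⊕ w⁻¹` has one; this is
the reason for doubling the size. -/
theorem stabHom_mem_trivialTorsion (H : IsLocalDet (augmentation ξ) d)
    {x : (Matrix κ κ (NovikovRing ξ))ˣ} (hx : x ∈ commutator (Matrix κ κ (NovikovRing ξ))ˣ) :
    stabHom x ∈ trivialTorsion (κ ⊕ κ) H := by
  suffices commutator (Matrix κ κ (NovikovRing ξ))ˣ ≤ (trivialTorsion (κ ⊕ κ) H).comap stabHom from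
    this hx
  rw [commutator_def, Subgroup.commutator_le]
  intro x _ y _
  rw [Subgroup.mem_comap, commutatorElement_def, stabHom_commutator]
  exact mul_mem (mul_mem (diag_inv_mem_trivialTorsion H _) (diag_inv_mem_trivialTorsion H _))
    (diag_inv_mem_trivialTorsion H _)

/-! ### The torsion of a Toeplitz operator with power series symbol -/

/-- The inverse of `1 - σ z`. -/
noncomputable def geom (ξ : RingAut A) : twistedPowerSeries (mapAut ξ) :=
  ofCoeff (mapAut ξ) fun n => ofCols fun j => Finsupp.single (j + n.toNat) 1

theorem entry_coeffHom_geom {n : ℤ} (hn : 0 ≤ n) (i j : ℕ) :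
    entry i j (coeffHom (mapAut ξ) n (geom ξ)) = if (i : ℤ) = j + n then 1 else 0 := by
  rw [geom, coeffHom_ofCoeff _ hn, entry_ofCols, Finsupp.single_apply]
  congr 1
  exact propext ⟨fun h => by lia, fun h => by lia⟩

theorem coeffHom_z_mul {B : Type*} [Ring B] {η : RingAut B} (f : twistedPowerSeries η) (n : ℤ) :
    coeffHom η n (z η * f) = (η ^ (-1 : ℤ)) (coeffHom η (n - 1) f) := by
  have := NovikovRing.coeff_monomial_mul 1 1 (f : NovikovRing η) n
  rw [one_mul] at this
  exact this

/-- Geometric series: the twist fixes `σ`, so `(σ z)ⁿ = σⁿ zⁿ`. -/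
theorem one_sub_shift_mul_geom :
    (1 - const (mapAut ξ) shift * z (mapAut ξ)) * geom ξ = 1 := by
  refine ext_coeff fun n hn => ext_entry fun i j => ?_
  have h1 : coeffHom (mapAut ξ) n 1 = if n = 0 then 1 else 0 := by
    rw [← map_one (const (mapAut ξ)), coeffHom_const]
  rw [sub_mul, one_mul, mul_assoc, map_sub, coeffHom_const_mul, coeffHom_z_mul, map_sub,
    entry_coeffHom_geom hn, entry_shift_mul, entry_mapAut_zpow, h1]
  by_cases hn0 : n = 0
  · subst hn0
    rw [coeffHom_of_neg _ (by lia), map_zero, map_zero, ite_self, sub_zero, if_pos rfl, entry_one]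
    simp
  · rw [entry_coeffHom_geom (by lia), if_neg hn0, map_zero]
    split_ifs <;> first | lia | simp

theorem shiftUnit_inv_eq_geom : ((isUnit_one_sub_shift ξ).unit⁻¹).val = geom ξ :=
  ((Units.inv_eq_of_mul_eq_one_right (u := (isUnit_one_sub_shift ξ).unit)
    one_sub_shift_mul_geom))

/-- The operator acting as the power series `f` on the first basis vector. -/
noncomputable def firstBlock (f : twistedPowerSeries ξ) : twistedPowerSeries (mapAut ξ) :=
  ofCoeff (mapAut ξ) fun n => ofCols fun j => if j = 0 then Finsupp.single 0 (coeffHom ξ n f) else 0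

theorem entry_coeffHom_firstBlock (f : twistedPowerSeries ξ) {n : ℤ} (hn : 0 ≤ n) (i j : ℕ) :
    entry i j (coeffHom (mapAut ξ) n (firstBlock f)) =
      if i = 0 ∧ j = 0 then coeffHom ξ n f else 0 := by
  rw [firstBlock, coeffHom_ofCoeff _ hn, entry_ofCols]
  split_ifs <;> simp [Finsupp.single_apply] <;> grind

theorem seriesEntry_firstBlock (f : twistedPowerSeries ξ) :
    seriesEntry ξ 0 0 (firstBlock f) = f :=
  ext_coeff fun n hn => by
    rw [coeffHom_seriesEntry _ _ _ hn, entry_coeffHom_firstBlock f hn, if_pos ⟨rfl, rfl⟩]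

/-- On the first basis vector this reads `T(f) ∑ eₙ zⁿ = (∑ eᵢ zⁱ) f`. It holds because `zⁱ f = ∑ₘ
ξ⁻ⁱ(fₘ) z^{m+i}`, and these coefficients are the entries of row `i` of `T(f)`. -/
theorem toeplitz_mul_geom (f : twistedPowerSeries ξ) :
    const (mapAut ξ) (toeplitz ξ f) * (geom ξ * const (mapAut ξ) (proj 1)) =
      geom ξ * firstBlock f := by
  refine ext_coeff fun n hn => ext_entry fun i j => ?_
  rw [coeffHom_const_mul, coeffHom_mul_const, ← map_zpow, mapAut_proj, ← mul_assoc,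
    entry_mul_proj, coeffHom_mul, map_sum]
  have h1 : ∀ p ∈ Finset.Icc 0 n, entry i j (coeffHom (mapAut ξ) p (geom ξ) *
      (mapAut ξ ^ (-p)) (coeffHom (mapAut ξ) (n - p) (firstBlock f))) =
      if p = i ∧ j = 0 then (ξ ^ (-p)) (coeffHom ξ (n - p) f) else 0 := by
    intro p hp
    rw [Finset.mem_Icc] at hp
    rw [entry_mul _ _ i j 1, Finset.sum_range_one, entry_coeffHom_geom hp.1, entry_mapAut_zpow,
      entry_coeffHom_firstBlock f (by lia)]
    · simp only [Nat.cast_zero, zero_add, true_and]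
      split_ifs <;> first | lia | simp
    · intro k hk
      rw [entry_mapAut_zpow, entry_coeffHom_firstBlock f (by lia), if_neg (by lia), map_zero]
  rw [Finset.sum_congr rfl h1]
  by_cases hj : j = 0
  · subst hj
    simp only [and_true]
    rw [Finset.sum_ite_eq', if_pos (by lia)]
    have h2 : ∀ k, (n.toNat + 1) ≤ k → entry k 0 (coeffHom (mapAut ξ) n (geom ξ)) = 0 := by
      intro k hk
      rw [entry_coeffHom_geom hn, if_neg (by lia)]
    rw [entry_mul _ _ i 0 _ h2, Finset.sum_eq_single_of_mem n.toNat (by simp),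
      entry_coeffHom_geom hn, if_pos (by lia), mul_one, entry_toeplitz]
    · rw [show ((n.toNat : ℕ) : ℤ) = n by lia]
      split_ifs with h
      · rfl
      · rw [Finset.mem_Icc] at h
        rw [f.2 _ (by lia), map_zero]
    · intro k _ hk
      rw [entry_coeffHom_geom hn, if_neg (by lia), mul_zero]
  · rw [if_neg (by lia), Finset.sum_eq_zero]
    intro p _
    rw [if_neg (by tauto)]

/-- On the first basis vector, `T(h)` passes through the geometric series as right multiplication by
`h`, and `1 - σ z` then cancels that series. What remains is `T(u)` applied to `e₀ h`, whose first
entry is `u₀ h = h`. -/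
theorem seriesEntry_shiftCommutator {u h : twistedPowerSeries ξ} (hu : augmentation ξ u = 1) :
    seriesEntry ξ 0 0 (const (mapAut ξ) (toeplitz ξ u) *
      (1 - const (mapAut ξ) shift * z (mapAut ξ)) * const (mapAut ξ) (toeplitz ξ h) * geom ξ) =
      h := by
  have h1 : seriesEntry ξ 0 0 (1 : twistedPowerSeries (mapAut ξ)) = 1 := by
    rw [← map_one (const (mapAut ξ)), seriesEntry_const, entry_one, if_pos rfl, map_one]
  have h2 := seriesEntry_mul (ξ := ξ) 0 0 1 (const (mapAut ξ) (toeplitz ξ u) *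
      (1 - const (mapAut ξ) shift * z (mapAut ξ)) * const (mapAut ξ) (toeplitz ξ h) * geom ξ) 1
  have h4 : firstBlock h = const (mapAut ξ) (proj 1) * firstBlock h := by
    refine ext_coeff fun n hn => ext_entry fun i j => ?_
    rw [coeffHom_const_mul, entry_proj_mul, entry_coeffHom_firstBlock h hn]
    split_ifs <;> first | rfl | lia
  have h3 : const (mapAut ξ) (toeplitz ξ u) *
      (1 - const (mapAut ξ) shift * z (mapAut ξ)) * const (mapAut ξ) (toeplitz ξ h) * geom ξ *
      const (mapAut ξ) (proj 1) =
      const (mapAut ξ) (toeplitz ξ u) * const (mapAut ξ) (proj 1) * firstBlock h := by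
    rw [mul_assoc _ (geom ξ), mul_assoc _ (const (mapAut ξ) (toeplitz ξ h)), toeplitz_mul_geom,
      ← mul_assoc, mul_assoc (const (mapAut ξ) (toeplitz ξ u)), one_sub_shift_mul_geom, mul_one,
      mul_assoc, ← h4]
  rw [Finset.sum_range_one, h1, mul_one, mul_one, h3, seriesEntry_mul, Finset.sum_range_one,
    seriesEntry_firstBlock, seriesEntry_const, entry_toeplitz] at h2
  rw [← h2]
  have h5 : (u : NovikovRing ξ).coeff 0 = 1 := hu
  simp [h5]

end ColumnFinite

/-- The diagonal matrix with one prescribed entry and all other diagonal entries equal to `1`. -/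
def diagSingle {B κ : Type*} [Ring B] [Fintype κ] [DecidableEq κ] (k : κ) : B →* Matrix κ κ B :=
  (Matrix.diagonalRingHom κ B).toMonoidHom.comp (MonoidHom.mulSingle (fun _ => B) k)

theorem diagSingle_apply {B κ : Type*} [Ring B] [Fintype κ] [DecidableEq κ] (k : κ) (b : B)
    (i j : κ) : diagSingle k b i j = if i = j then if i = k then b else 1 else 0 := by
  change Matrix.diagonal (Pi.mulSingle k b) i j = _
  rw [Matrix.diagonal_apply, Pi.mulSingle_apply]

namespace ColumnFinite

variable {A V : Type*} [Ring A] [CommGroup V] {ξ : RingAut A} {κ : Type} [Fintype κ]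
  [DecidableEq κ] {d : twistedPowerSeries ξ → V}

theorem matToeplitz_diagSingle (k : κ) (f : NovikovRing ξ) :
    matToeplitz (diagSingle k f) = diagSingle k (toeplitz ξ f) := by
  ext1 i j
  rw [matToeplitz, Matrix.map_apply, diagSingle_apply, diagSingle_apply, apply_ite (toeplitz ξ),
    apply_ite (toeplitz ξ), map_zero, toeplitz_one]

/-- The Toeplitz operator of an invertible power series. -/
noncomputable def toeplitzUnit (u : (twistedPowerSeries ξ)ˣ) : (ColumnFinite A)ˣ where
  val := toeplitz ξ (u : twistedPowerSeries ξ)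
  inv := toeplitz ξ ((u⁻¹ : (twistedPowerSeries ξ)ˣ) : twistedPowerSeries ξ)
  val_inv := by
    rw [← toeplitz_mul_of_mem (Subtype.prop _), ← Subring.coe_mul, Units.mul_inv, Subring.coe_one,
      toeplitz_one]
  inv_val := by
    rw [← toeplitz_mul_of_mem (Subtype.prop _), ← Subring.coe_mul, Units.inv_mul, Subring.coe_one,
      toeplitz_one]

/-- The commutator differs from `1` only in row `0`, so corners of size one suffice. Away from block
`k` it is the identity, and at `k` its corner entry is `u⁻¹`. -/
theorem torsion_toeplitzUnit (H : IsLocalDet (augmentation ξ) d) (k : κ)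
    (u : (twistedPowerSeries ξ)ˣ) (hu : augmentation ξ (u : twistedPowerSeries ξ) = 1) :
    torsion ξ d (Units.map (diagSingle k) (toeplitzUnit u)) =
      d ((u⁻¹ : (twistedPowerSeries ξ)ˣ) : twistedPowerSeries ξ) := by
  set h := ((u⁻¹ : (twistedPowerSeries ξ)ˣ) : twistedPowerSeries ξ) with hh
  have hε : augmentation ξ h = 1 := by
    have := congrArg (augmentation ξ) u.mul_inv
    rwa [map_mul, hu, one_mul, map_one] at this
  set U := Units.map (matConst ξ κ).toMonoidHom (Units.map (diagSingle k) (toeplitzUnit u))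
  have e1 : U.val = matConst ξ κ (matToeplitz (diagSingle k ((u : twistedPowerSeries ξ) :
      NovikovRing ξ))) := by
    rw [matToeplitz_diagSingle]
    rfl
  have hfix : seriesProj ξ κ 1 * ((shiftCommutator U).val - 1) = (shiftCommutator U).val - 1 := by
    rw [shiftCommutator_sub_one, e1, ← mul_assoc, ← mul_assoc, seriesProj_one_mul_commutator]
  have hconst : ∀ X : ColumnFinite A, matConst ξ κ (diagSingle k X) =
      diagSingle k (const (mapAut ξ) X) := by
    intro X
    ext1 i j
    rw [diagSingle_apply]
    change const (mapAut ξ) (diagSingle k X i j) = _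
    rw [diagSingle_apply, apply_ite (const (mapAut ξ)), apply_ite (const (mapAut ξ)), map_zero,
      map_one]
  have hval : (shiftCommutator U).val = diagSingle k
      (const (mapAut ξ) (toeplitz ξ u) * (1 - const (mapAut ξ) shift * z (mapAut ξ)) *
        const (mapAut ξ) (toeplitz ξ h) * geom ξ) := by
    have hg : (1 - const (mapAut ξ) shift * z (mapAut ξ)) * geom ξ = 1 := one_sub_shift_mul_geom
    have e2 : (shiftCommutator U).val = diagSingle k (const (mapAut ξ) (toeplitz ξ u)) *
        (Matrix.diagonal fun _ => 1 - const (mapAut ξ) shift * z (mapAut ξ)) *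
        diagSingle k (const (mapAut ξ) (toeplitz ξ h)) * Matrix.diagonal fun _ => geom ξ := by
      rw [← hconst, ← hconst, ← shiftUnit_inv_eq_geom]
      rfl
    rw [e2]
    change Matrix.diagonal _ * _ * Matrix.diagonal _ * _ = Matrix.diagonal _
    rw [Matrix.diagonal_mul_diagonal, Matrix.diagonal_mul_diagonal, Matrix.diagonal_mul_diagonal]
    congr 1
    funext i
    simp only [MonoidHom.mulSingle_apply, Pi.mulSingle_apply]
    split_ifs
    · rfl
    · rw [one_mul, mul_one, hg]
  have hcorner : corner 1 1 (shiftCommutator U).val =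
      1 + Matrix.single (k, 0) (k, 0) (h - 1) := by
    have h1 : seriesEntry ξ 0 0 (1 : twistedPowerSeries (mapAut ξ)) = 1 := by
      rw [← map_one (const (mapAut ξ)), seriesEntry_const, entry_one, if_pos rfl, map_one]
    ext1 ⟨i, i'⟩ ⟨j, j'⟩
    obtain rfl : i' = 0 := Subsingleton.elim _ _
    obtain rfl : j' = 0 := Subsingleton.elim _ _
    rw [hval]
    change seriesEntry ξ 0 0 (diagSingle k _ i j) = _
    rw [diagSingle_apply, Matrix.add_apply, Matrix.one_apply, Matrix.single_apply]
    simp only [Prod.mk.injEq, and_true]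
    by_cases hij : i = j
    · subst hij
      by_cases hik : i = k
      · subst hik
        simp only [if_true, and_self]
        rw [seriesEntry_shiftCommutator hu, add_sub_cancel]
      · rw [if_pos rfl, if_neg hik, if_pos rfl, if_neg (by tauto), h1, add_zero]
    · rw [if_neg hij, if_neg hij, if_neg (by rintro ⟨rfl, rfl⟩; exact hij rfl), map_zero, add_zero]
  rw [torsion, finDet_eq H (Units.isUnit _) hfix, hcorner, LocalDet.extDet_one_add_single H,
    add_sub_cancel]
  rw [map_sub, hε, map_one, sub_self]

/-- An invertible power series with constant term `1` whose class is a product of commutators of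
invertible matrices has trivial determinant. -/
theorem det_eq_one_of_mem_commutator (H : IsLocalDet (augmentation ξ) d) (k : κ)
    (u : (twistedPowerSeries ξ)ˣ) (hu : augmentation ξ (u : twistedPowerSeries ξ) = 1)
    (hc : Units.map (diagSingle k) (Units.map ((twistedPowerSeries ξ).subtype :
      twistedPowerSeries ξ →* NovikovRing ξ) u) ∈ commutator (Matrix κ κ (NovikovRing ξ))ˣ) :
    d ((u⁻¹ : (twistedPowerSeries ξ)ˣ) : twistedPowerSeries ξ) = 1 := by
  rw [← torsion_toeplitzUnit H (Sum.inl k : κ ⊕ κ) u hu]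
  refine torsion_eq_one_of_isLift H (stabHom_mem_trivialTorsion H hc) ?_
  have e : (BlockUnit.stabHom (Units.map (diagSingle k) (Units.map ((twistedPowerSeries ξ).subtype :
      twistedPowerSeries ξ →* NovikovRing ξ) u))).val =
      diagSingle (Sum.inl k : κ ⊕ κ) ((u : twistedPowerSeries ξ) : NovikovRing ξ) := by
    change fromBlocks (diagSingle k _) 0 0 1 = _
    ext (i | i) (j | j) : 2
    · simp only [fromBlocks_apply₁₁, diagSingle_apply, Sum.inl.injEq]
      rfl
    · simp [diagSingle_apply]
    · simp [diagSingle_apply]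
    · simp [diagSingle_apply, Matrix.one_apply]
  rw [e]
  have := isLift_matToeplitz (diagSingle (Sum.inl k : κ ⊕ κ) ((u : twistedPowerSeries ξ) :
    NovikovRing ξ))
  rwa [matToeplitz_diagSingle] at this

end ColumnFinite

/-! ### The quotient of `1 + A_ξ[[z]]z` by the subgroup `C` -/

namespace twistedPowerSeries

variable {A : Type*} [Ring A] {ξ : RingAut A}

/-- An element with constant term `1` as an element of the group `1 + A_ξ[[z]]z`. -/
noncomputable def toOneAddIdeal (u : twistedPowerSeries ξ) (hu : augmentation ξ u = 1) :
    oneAddIdeal ξ :=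
  ⟨(isUnit_of_augmentation_eq_one u hu).unit, (mem_oneAddIdeal _).2 hu⟩

theorem mk_eq_mk_of_comm {u v : oneAddIdeal ξ} (a b : twistedPowerSeries ξ)
    (hab : augmentation ξ (a * b) = 0) (hba : augmentation ξ (b * a) = 0)
    (hu : ((u : (twistedPowerSeries ξ)ˣ) : twistedPowerSeries ξ) = 1 + a * b)
    (hv : ((v : (twistedPowerSeries ξ)ˣ) : twistedPowerSeries ξ) = 1 + b * a) :
    (QuotientGroup.mk u : oneAddIdeal ξ ⧸ commSubgroup ξ) = QuotientGroup.mk v := by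
  have h : u * v⁻¹ ∈ commSubgroup ξ :=
    Subgroup.subset_closure ⟨a, b, u, v, hab, hba, hu, hv, rfl⟩
  rw [← QuotientGroup.eq_one_iff, QuotientGroup.mk_mul, QuotientGroup.mk_inv] at h
  exact mul_inv_eq_one.1 h

/-- One has `u v = 1 + u (v - u⁻¹)` and `v u = 1 + (v - u⁻¹) u`, with `v - u⁻¹` vanishing under `ε`;
so `C` contains all commutators. -/
noncomputable instance : CommGroup (oneAddIdeal ξ ⧸ commSubgroup ξ) where
  __ := (inferInstance : Group (oneAddIdeal ξ ⧸ commSubgroup ξ))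
  mul_comm x y := by
    induction x, y using Quotient.inductionOn₂' with | _ u v
    have hu := (mem_oneAddIdeal _).1 u.2
    have hv := (mem_oneAddIdeal _).1 v.2
    have hu' := (mem_oneAddIdeal _).1 (u⁻¹).2
    set a := ((u : (twistedPowerSeries ξ)ˣ) : twistedPowerSeries ξ)
    set b := ((v : (twistedPowerSeries ξ)ˣ) : twistedPowerSeries ξ)
    set a' := (((u⁻¹ : oneAddIdeal ξ) : (twistedPowerSeries ξ)ˣ) : twistedPowerSeries ξ)
    have h1 : a * a' = 1 := Units.mul_inv _
    have h2 : a' * a = 1 := Units.inv_mul _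
    refine mk_eq_mk_of_comm a (b - a') ?_ ?_ ?_ ?_
    · rw [map_mul, map_sub, hv, hu', sub_self, mul_zero]
    · rw [map_mul, map_sub, hv, hu', sub_self, zero_mul]
    · rw [mul_sub, h1, add_sub_cancel]
      rfl
    · rw [sub_mul, h2, add_sub_cancel]
      rfl

open Classical in
/-- The class in `(1 + A_ξ[[z]]z) / C` of a power series with constant term `1`. -/
noncomputable def quotientClass (ξ : RingAut A) (u : twistedPowerSeries ξ) :
    oneAddIdeal ξ ⧸ commSubgroup ξ :=
  if hu : augmentation ξ u = 1 then QuotientGroup.mk (toOneAddIdeal u hu) else 1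

theorem quotientClass_val (u : oneAddIdeal ξ) :
    quotientClass ξ ((u : (twistedPowerSeries ξ)ˣ) : twistedPowerSeries ξ) =
      QuotientGroup.mk u := by
  rw [quotientClass, dif_pos ((mem_oneAddIdeal _).1 u.2)]
  congr 1
  exact Subtype.ext (Units.ext rfl)

theorem isLocalDet_quotientClass (ξ : RingAut A) :
    IsLocalDet (augmentation ξ) (quotientClass ξ) where
  isUnit := isUnit_of_augmentation_eq_one
  mul u v hu hv := by
    have huv : augmentation ξ (u * v) = 1 := by rw [map_mul, hu, hv, one_mul]
    rw [quotientClass, quotientClass, quotientClass, dif_pos hu, dif_pos hv, dif_pos huv,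
      ← QuotientGroup.mk_mul]
    congr 1
    exact Subtype.ext (Units.ext rfl)
  comm a b hb := by
    have h1 : augmentation ξ (a * b) = 0 := by rw [map_mul, hb, mul_zero]
    have h2 : augmentation ξ (b * a) = 0 := by rw [map_mul, hb, zero_mul]
    have h3 : augmentation ξ (1 + a * b) = 1 := by rw [map_add, map_one, h1, add_zero]
    have h4 : augmentation ξ (1 + b * a) = 1 := by rw [map_add, map_one, h2, add_zero]
    rw [quotientClass, quotientClass, dif_pos h3, dif_pos h4]
    exact mk_eq_mk_of_comm a b h1 h2 rfl rfl

end twistedPowerSeries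

/-! ### The map to `K₁` -/

namespace K1

variable {R : Type*} [Ring R]

theorem of_stab {n m : ℕ} (h : n ≤ m) (α : GL (Fin n) R) :
    StableGL.of R m (StableGL.stab R n m h α) = StableGL.of R n α := by
  change (⟦⟨m, _⟩⟧ : StableGL R) = ⟦⟨n, α⟩⟧
  exact (DirectLimit.eq_of_le (f := StableGL.stab R) ⟨n, α⟩ m h).symm

/-- A product of commutators in the limit involves finitely many matrices, so it comes from one
stage, and its equality with the class of `α` holds at a possibly later one. -/
theorem exists_stab_mem_commutator {n : ℕ} {α : GL (Fin n) R}
    (hα : StableGL.of R n α ∈ commutator (StableGL R)) :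
    ∃ (m : ℕ) (h : n ≤ m), StableGL.stab R n m h α ∈ commutator (GL (Fin m) R) := by
  have hmap : ∀ {k m : ℕ} (h : k ≤ m) {β : GL (Fin k) R}, β ∈ commutator (GL (Fin k) R) →
      StableGL.stab R k m h β ∈ commutator (GL (Fin m) R) := by
    intro k m h β hβ
    suffices commutator (GL (Fin k) R) ≤
      (commutator (GL (Fin m) R)).comap (StableGL.stab R k m h) from this hβ
    rw [commutator_def, Subgroup.commutator_le]
    intro x _ y _
    rw [Subgroup.mem_comap, map_commutatorElement]
    exact Subgroup.commutator_mem_commutator (Subgroup.mem_top _) (Subgroup.mem_top _)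
  let S : Subgroup (StableGL R) :=
    { carrier := {x | ∃ (k : ℕ) (β : GL (Fin k) R), β ∈ commutator (GL (Fin k) R) ∧
        StableGL.of R k β = x}
      one_mem' := ⟨0, 1, one_mem _, map_one _⟩
      mul_mem' := by
        rintro _ _ ⟨k, β, hβ, rfl⟩ ⟨l, γ, hγ, rfl⟩
        refine ⟨max k l, StableGL.stab R k _ (le_max_left k l) β *
          StableGL.stab R l _ (le_max_right k l) γ, mul_mem (hmap _ hβ) (hmap _ hγ), ?_⟩
        rw [map_mul, of_stab, of_stab]
      inv_mem' := by
        rintro _ ⟨k, β, hβ, rfl⟩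
        exact ⟨k, β⁻¹, inv_mem hβ, map_inv _ _⟩ }
  have hS : commutator (StableGL R) ≤ S := by
    rw [commutator_def, Subgroup.commutator_le]
    intro x _ y _
    obtain ⟨k, β, γ, rfl, rfl⟩ := DirectLimit.exists_eq_mk₂ (StableGL.stab R) x y
    refine ⟨k, β * γ * β⁻¹ * γ⁻¹, Subgroup.commutator_mem_commutator (Subgroup.mem_top β)
      (Subgroup.mem_top γ), ?_⟩
    rw [commutatorElement_def, map_mul, map_mul, map_mul, map_inv, map_inv]
    rfl
  obtain ⟨k, β, hβ, h⟩ := hS hα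
  obtain ⟨m, h1, h2, h3⟩ := Quotient.exact h
  exact ⟨m, h2, by
    have := hmap h1 hβ
    rwa [show StableGL.stab R k m h1 β = StableGL.stab R n m h2 α from h3] at this⟩

theorem stab_scalar {m : ℕ} (u : Rˣ) (h : 1 ≤ m) :
    StableGL.stab R 1 m h (Units.map (Matrix.scalar (Fin 1) :
      R →+* Matrix (Fin 1) (Fin 1) R).toMonoidHom u) =
      Units.map (diagSingle (⟨0, h⟩ : Fin m)) u := by
  refine Units.ext (Matrix.ext fun i j => ?_)
  change StableGL.blockMatrix (Matrix.scalar (Fin 1) (u : R)) i j = diagSingle _ (u : R) i j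
  rw [StableGL.blockMatrix, Matrix.of_apply, diagSingle_apply]
  simp only [Fin.ext_iff]
  by_cases hij : (i : ℕ) < 1 ∧ (j : ℕ) < 1
  · rw [dif_pos hij, if_pos (by lia), if_pos (by lia),
      Subsingleton.elim (⟨i, hij.1⟩ : Fin 1) ⟨j, hij.2⟩, Matrix.scalar_apply,
      Matrix.diagonal_apply_eq]
  · rw [dif_neg hij]
    split_ifs <;> first | rfl | lia

theorem ofUnit_eq_one_iff_exists {u : Rˣ} (hu : K1.ofUnit R u = 1) :
    ∃ (m : ℕ) (h : 1 ≤ m),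
      Units.map (diagSingle (⟨0, h⟩ : Fin m)) u ∈ commutator (GL (Fin m) R) := by
  obtain ⟨m, h, hm⟩ := exists_stab_mem_commutator ((QuotientGroup.eq_one_iff _).1 hu)
  exact ⟨m, h, by rwa [stab_scalar] at hm⟩

/-! ### Elementary matrices and the relation `[1 + ab] = [1 + ba]` in `K₁`. -/

/-- An elementary matrix. -/
def elementary {κ : Type*} [Fintype κ] [DecidableEq κ] (i j : κ) (h : i ≠ j) (x : R) :
    (Matrix κ κ R)ˣ where
  val := 1 + Matrix.single i j x
  inv := 1 - Matrix.single i j x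
  val_inv := by
    have : Matrix.single i j x * Matrix.single i j x = 0 :=
      Matrix.single_mul_single_of_ne _ _ _ _ h.symm _
    rw [mul_sub, mul_one, add_mul, one_mul, this]
    abel
  inv_val := by
    have : Matrix.single i j x * Matrix.single i j x = 0 :=
      Matrix.single_mul_single_of_ne _ _ _ _ h.symm _
    rw [sub_mul, one_mul, mul_add, mul_one, this]
    abel

/-- `e_ij(x)` is the commutator of `e_ik(x)` and `e_kj(1)`. This needs a third index, hence the
matrices of size `3` below. -/
theorem map_elementary {κ K : Type*} [Fintype κ] [DecidableEq κ] [CommGroup K]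
    (χ : (Matrix κ κ R)ˣ →* K) {i j k : κ} (hij : i ≠ j) (hik : i ≠ k) (hkj : k ≠ j) (x : R) :
    χ (elementary i j hij x) = 1 := by
  have e : elementary i j hij x = elementary i k hik x * elementary k j hkj 1 *
      (elementary i k hik x)⁻¹ * (elementary k j hkj 1)⁻¹ := by
    refine Units.ext ?_
    change 1 + Matrix.single i j x = (1 + Matrix.single i k x) * (1 + Matrix.single k j 1) *
      (1 - Matrix.single i k x) * (1 - Matrix.single k j 1)
    have h1 : Matrix.single i k x * Matrix.single k j 1 = Matrix.single i j x := by
      rw [Matrix.single_mul_single_same, mul_one]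
    have h2 : Matrix.single k j (1 : R) * Matrix.single i k x = 0 :=
      Matrix.single_mul_single_of_ne _ _ _ _ hij.symm _
    have h3 : Matrix.single i k x * Matrix.single i k x = 0 :=
      Matrix.single_mul_single_of_ne _ _ _ _ hik.symm _
    have h4 : Matrix.single k j (1 : R) * Matrix.single k j 1 = 0 :=
      Matrix.single_mul_single_of_ne _ _ _ _ hkj.symm _
    rw [← h1]
    generalize Matrix.single i k x = E at h2 h3
    generalize Matrix.single k j (1 : R) = F at h2 h4
    have : (1 + E) * (1 + F) * (1 - E) * (1 - F) = 1 + E * F - E * E - F * F - E * (F * F) -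
        F * E - E * (F * E) + E * E * F + F * E * F + E * (F * E) * F := by noncomm_ring
    rw [this, h2, h3, h4]
    simp
  rw [e, map_mul, map_mul, map_mul, map_inv, map_inv, mul_comm (χ _) (χ _), mul_inv_cancel_right,
    mul_inv_cancel]

/-- The same identity as in `extDet_comm`, with `1 × 1` blocks; the third coordinate only serves to
kill the elementary factors. -/
theorem map_diagSingle_comm {K : Type*} [CommGroup K] (χ : GL (Fin 3) R →* K) (a b : R)
    (u v : Rˣ) (hu : (u : R) = 1 + a * b) (hv : (v : R) = 1 + b * a) :
    χ (Units.map (diagSingle 0) u) = χ (Units.map (diagSingle 1) v) := by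
  have e : elementary (0 : Fin 3) 1 (by decide) (-a) * Units.map (diagSingle 0) u *
      elementary 1 0 (by decide) b =
      elementary 1 0 (by decide) b * Units.map (diagSingle 1) v *
        elementary (0 : Fin 3) 1 (by decide) (-a) := by
    refine Units.ext (Matrix.ext fun i j => ?_)
    change ((1 + Matrix.single 0 1 (-a)) * diagSingle 0 (u : R) * (1 + Matrix.single 1 0 b) :
        Matrix (Fin 3) (Fin 3) R) i j =
      ((1 + Matrix.single 1 0 b) * diagSingle 1 (v : R) * (1 + Matrix.single 0 1 (-a)) :
        Matrix (Fin 3) (Fin 3) R) i j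
    fin_cases i <;> fin_cases j <;>
      simp [Matrix.mul_apply, Fin.sum_univ_three, diagSingle_apply, Matrix.one_apply,
        Matrix.single_apply, hu, hv]
  have h := congrArg χ e
  simp only [map_mul] at h
  rwa [map_elementary χ (k := 2) _ (by decide) (by decide),
    map_elementary χ (k := 2) _ (by decide) (by decide), one_mul, mul_one, one_mul, mul_one] at h

theorem ofUnit_comm (a b : R) (u v : Rˣ) (hu : (u : R) = 1 + a * b) (hv : (v : R) = 1 + b * a) :
    K1.ofUnit R u = K1.ofUnit R v := by
  have h : ∀ u : Rˣ, K1.ofUnit R u = Abelianization.of.comp (StableGL.of R 3)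
      (Units.map (diagSingle (0 : Fin 3)) u) := by
    intro u
    have := stab_scalar u (show 1 ≤ 3 by decide)
    rw [MonoidHom.comp_apply]
    rw [show (0 : Fin 3) = ⟨0, by decide⟩ from rfl, ← this, of_stab]
    rfl
  rw [h, h, map_diagSingle_comm _ a b u v hu hv]
  -- The factors `b a` and `1` commute, so the same relation moves `v` from position `1` back to
  -- position `0`.
  refine (map_diagSingle_comm _ (b * a) 1 v v ?_ ?_).symm
  · rw [hv, mul_one]
  · rw [hv, one_mul]

end K1

/-- The torsion argument is applied at a finite stage with the quotient map by `C` as determinant.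
It yields the triviality of the class of `u⁻¹`, hence of `u`. -/
theorem ker_oneAddIdealToK1 {A : Type*} [Ring A] (ξ : RingAut A) :
    (oneAddIdealToK1 ξ).ker = commSubgroup ξ := by
  refine le_antisymm (fun u hu => ?_) ?_
  · obtain ⟨m, h, hm⟩ := K1.ofUnit_eq_one_iff_exists ((MonoidHom.mem_ker).1 hu)
    have := ColumnFinite.det_eq_one_of_mem_commutator (isLocalDet_quotientClass ξ)
      (⟨0, h⟩ : Fin m) (u : (twistedPowerSeries ξ)ˣ) ((mem_oneAddIdeal _).1 u.2) hm
    have h2 := quotientClass_val u⁻¹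
    rw [Subgroup.coe_inv, this, eq_comm, QuotientGroup.eq_one_iff] at h2
    exact (Subgroup.inv_mem_iff _).1 h2
  · rw [commSubgroup, Subgroup.closure_le]
    rintro _ ⟨a, b, u, v, -, -, hu, hv, rfl⟩
    rw [SetLike.mem_coe, MonoidHom.mem_ker, map_mul, map_inv, mul_inv_eq_one]
    refine K1.ofUnit_comm (a : NovikovRing ξ) b _ _ ?_ ?_
    · exact congrArg Subtype.val hu
    · exact congrArg Subtype.val hv

theorem mainTheorem5 {A : Type*} [Ring A] (ξ : RingAut A) :
    ∃ e : (twistedPowerSeries.oneAddIdeal ξ ⧸ twistedPowerSeries.commSubgroup ξ) ≃* W1 ξ,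
      ∀ u : twistedPowerSeries.oneAddIdeal ξ,
        (e (QuotientGroup.mk u) : K1 (NovikovRing ξ)) = oneAddIdealToK1 ξ u :=
  ⟨(QuotientGroup.quotientMulEquivOfEq (ker_oneAddIdealToK1 ξ).symm).trans
    (QuotientGroup.quotientKerEquivRange (oneAddIdealToK1 ξ)), fun _ => rfl⟩
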